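/- Let $n\ge 2$, let $\Omega\subset\mathbb R^n$ be a bounded Lipschitz domain, let $1<p,q<\infty$, and let $A\subset\subset\Omega$ be an open set with Lipschitz boundary and finitely many connected components (possibly empty) such that $B:=\Omega\setminus\overline A$ is connected. Let $X^p_\diamond(\partial\Omega)$ be the space of $f\in L^p(\partial\Omega)$ with $\int_{\partial\Omega}f\,dS=0$ and finite norm $$\|f\|_{X^p}=\|f\|_{L^p(\partial\Omega)}+\Big(\int_{\partial\Omega}\int_{\partial\Omega}\frac{|f(x)-f(y)|^p}{|x-y|^{n-1+(1-\frac1p)p}}\,dS(y)\,dS(x)\Big)^{1/p},$$ where $dS$ is the $(n-1)$-dimensional Hausdorff measure; $u=f$ on $\partial\Omega$ is meant in the sense of traces. The conductivity $\sigma(x,E)\in[0,\infty]$ ($x\in\Omega$, $E>0$) is such that on $B$ it is a Carathéodory function (measurable in $x$, continuous in $E$), and for given constants $0<\underline\sigma\le\overline\sigma$, $E_0>0$ and a.e. $x\in B$, all $E>0$, $$\underline\sigma\Big(\frac E{E_0}\Big)^{p-2}\le\sigma(x,E)\le\begin{cases}\overline\sigma\big[1+(E/E_0)^{p-2}\big]&p\ge2,\\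 \overline\sigma\,(E/E_0)^{p-2}&1<p<2,\end{cases}$$ and, for some $\kappa>0$, a.e. $x\in B$ and all $v_1,v_2\in\mathbb R^n$, the quantity $\big(\sigma(x,|v_2|)v_2-\sigma(x,|v_1|)v_1\big)\cdot(v_2-v_1)$ (with $\sigma(x,|v|)v:=0$ for $v=0$) is at least $\kappa|v_2-v_1|^p$ if $p\ge2$ and at least $\kappa(1+|v_2|^2+|v_1|^2)^{\frac{p-2}2}|v_2-v_1|^2$ if $1<p<2$. Put $Q_\sigma(x,E)=\int_0^E\sigma(x,\xi)\,\xi\,d\xi$. Let $f\in X^p_\diamond(\partial\Omega)$. Then the following hold, with constants $C$ independent of $f$ and of $\sigma$ apart from the constants in its growth bounds. (i) If $A=\emptyset$ and $u^f$ minimizes $\int_\Omega Q_\sigma(x,|\nabla u|)\,dx$ over $u\in W^{1,p}(\Omega)$ with $u=f$ on $\partial\Omega$, then $$\|\nabla u^f\|_{L^p(\Omega)}\le C(1+\|f\|_{X^p}),\qquad C=C(p,\Omega,\underline\sigma,\overline\sigma,E_0).$$ (ii) Suppose that on $A$ the function $\sigma$ satisfies the same three conditions with $q$ in place of $p$ and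 growth constants $0<\underline\sigma'\le\overline\sigma'$, $E_0'>0$. If $u^f$ minimizes $\int_B Q_\sigma(x,|\nabla u|)\,dx+\int_A Q_\sigma(x,|\nabla u|)\,dx$ over $u\in W^{1,p}(\Omega)\cup W^{1,q}(\Omega)$ with $u=f$ on $\partial\Omega$, then $$\|\nabla u^f\|_{L^p(B)},\ \|\nabla u^f\|_{L^q(A)}^{q/p}\ \le\ \big(\|\nabla u^f\|^p_{L^p(B)}+\|\nabla u^f\|^q_{L^q(A)}\big)^{1/p}\ \le\ C(1+\|f\|_{X^p}),$$ where, for any $\delta>0$ with $\operatorname{dist}(A,\partial\Omega)\ge\delta$, $C$ depends only on $p,q,\Omega,\delta$ and the growth constants $\underline\sigma,\overline\sigma,E_0,\underline\sigma',\overline\sigma',E_0'$. (iii) If $\sigma=0$ in $A$ (perfect insulator) and $u^f$ minimizes $\int_B Q_\sigma(x,|\nabla u|)\,dx$ over $u\in W^{1,p}(B)$ with $u=f$ on $\partial\Omega$, then $$\|\nabla u^f\|_{L^p(B)}\le C(1+\|f\|_{X^p}),\qquad C=C(p,\Omega,\underline\sigma,\overline\sigma,E_0).$$ (iv) If $\sigma=+\infty$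 in $A$ (perfect conductor) and $u^f$ minimizes $\int_B Q_\sigma(x,|\nabla u|)\,dx$ over $u\in W^{1,p}(\Omega)$ with $u=f$ on $\partial\Omega$ and $\nabla u=0$ a.e. in $A$, then $$\|\nabla u^f\|_{L^p(B)}\le C(1+\|f\|_{X^p}),$$ where, for any $\delta>0$ with $\operatorname{dist}(A,\partial\Omega)\ge\delta$, $C=C(p,\Omega,\delta,\underline\sigma,\overline\sigma,E_0)$. -/

import Mathlib

open MeasureTheory Filter Topology
open scoped ENNReal NNReal

noncomputable section

/-- `U ⊆ ℝⁿ` is a bounded open set with Lipschitz boundary: near each boundary point and for a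
suitable unit direction `e`, it is the region lying strictly above the graph, over the hyperplane
orthogonal to `e`, of a Lipschitz function `γ`. (The point `x - ⟪e, x⟫ e` is the orthogonal
projection of `x` onto that hyperplane.) The empty set is included. -/
structure IsBoundedLipschitzOpen {n : ℕ} (U : Set (EuclideanSpace ℝ (Fin n))) : Prop where
  isOpen : IsOpen U
  isBounded : Bornology.IsBounded U
  locally_graph : ∀ x₀ ∈ frontier U,
    ∃ (e : EuclideanSpace ℝ (Fin n)) (γ : EuclideanSpace ℝ (Fin n) → ℝ) (K : ℝ≥0) (r : ℝ),
      ‖e‖ = 1 ∧ LipschitzWith K γ ∧ 0 < r ∧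
        ∀ x ∈ Metric.ball x₀ r, (x ∈ U ↔ γ (x - inner ℝ e x • e) < inner ℝ e x)

/-- A bounded Lipschitz domain (nonempty, open, connected). -/
def IsLipschitzDomain {n : ℕ} (Ω : Set (EuclideanSpace ℝ (Fin n))) : Prop :=
  IsBoundedLipschitzOpen Ω ∧ IsConnected Ω

/-- The region `B = Ω \ closure A` of the outer material. -/
def outerPhase {n : ℕ} (Ω A : Set (EuclideanSpace ℝ (Fin n))) : Set (EuclideanSpace ℝ (Fin n)) :=
  Ω \ closure A

/-- `A` is an admissible inner region: a bounded open set with Lipschitz boundary, compactly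
contained in `Ω`, with finitely many connected components, whose outer region is a domain.
The case `A = ∅` is allowed. -/
structure IsInnerPhase {n : ℕ} (Ω A : Set (EuclideanSpace ℝ (Fin n))) : Prop where
  lipschitz : IsBoundedLipschitzOpen A
  closure_subset : closure A ⊆ Ω
  finite_components : Finite (ConnectedComponents A)
  outer_connected : IsConnected (outerPhase Ω A)

/-- The `(n-1)`-dimensional Hausdorff measure `dS` on the boundary of `Ω`. -/
def surfaceMeasure {n : ℕ} (Ω : Set (EuclideanSpace ℝ (Fin n))) :
    Measure (EuclideanSpace ℝ (Fin n)) :=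
  (Measure.euclideanHausdorffMeasure (n - 1)).restrict (frontier Ω)

/-- The Slobodeckij seminorm of order `1 - 1/p` on the boundary of `Ω`. -/
def slobodeckijSeminorm {n : ℕ} (Ω : Set (EuclideanSpace ℝ (Fin n))) (p : ℝ)
    (f : EuclideanSpace ℝ (Fin n) → ℝ) : ℝ≥0∞ :=
  (∫⁻ x, ∫⁻ y, ENNReal.ofReal (|f x - f y| ^ p / ‖x - y‖ ^ ((n : ℝ) - 1 + (1 - 1 / p) * p))
    ∂(surfaceMeasure Ω) ∂(surfaceMeasure Ω)) ^ (1 / p)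

/-- The norm of the trace space `X^p(∂Ω)`. -/
def traceNorm {n : ℕ} (Ω : Set (EuclideanSpace ℝ (Fin n))) (p : ℝ)
    (f : EuclideanSpace ℝ (Fin n) → ℝ) : ℝ≥0∞ :=
  eLpNorm f (ENNReal.ofReal p) (surfaceMeasure Ω) + slobodeckijSeminorm Ω p f

/-- `f ∈ X^p_⋄(∂Ω)`: finite trace norm and zero mean over the boundary. Only the values of `f`
on `∂Ω` matter. -/
structure MemTraceSpaceZeroMean {n : ℕ} (Ω : Set (EuclideanSpace ℝ (Fin n))) (p : ℝ)
    (f : EuclideanSpace ℝ (Fin n) → ℝ) : Prop where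
  memLp : MemLp f (ENNReal.ofReal p) (surfaceMeasure Ω)
  seminorm_lt_top : slobodeckijSeminorm Ω p f < ∞
  mean_zero : ∫ x, f x ∂(surfaceMeasure Ω) = 0

/-- `u ∈ W^{1,p}(U)` with weak gradient `Du`. -/
structure MemSobolev {n : ℕ} (U : Set (EuclideanSpace ℝ (Fin n))) (p : ℝ)
    (u : EuclideanSpace ℝ (Fin n) → ℝ)
    (Du : EuclideanSpace ℝ (Fin n) → EuclideanSpace ℝ (Fin n)) : Prop where
  memLp : MemLp u (ENNReal.ofReal p) (volume.restrict U)
  memLp_grad : MemLp Du (ENNReal.ofReal p) (volume.restrict U)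
  integral_by_parts : ∀ φ : EuclideanSpace ℝ (Fin n) → ℝ, ContDiff ℝ (⊤ : ℕ∞) φ →
    HasCompactSupport φ → tsupport φ ⊆ U → ∀ v : EuclideanSpace ℝ (Fin n),
      ∫ x in U, u x * fderiv ℝ φ x v = - ∫ x in U, inner ℝ (Du x) v * φ x

/-- `u ∈ W^{1,p}(U)`, with weak gradient `Du`, has trace `f` on the part `∂Ω` of the boundary of
`U`. Here `U` is a bounded Lipschitz open set whose boundary contains `∂Ω` (it is `Ω` itself or
the outer region). The trace is the continuous extension, from `W^{1,p}(U) ∩ C(closure U)` to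
`W^{1,p}(U)`, of the restriction to `∂Ω`, with values in `L^p(∂Ω)`. -/
def HasTrace {n : ℕ} (U Ω : Set (EuclideanSpace ℝ (Fin n))) (p : ℝ)
    (u : EuclideanSpace ℝ (Fin n) → ℝ)
    (Du : EuclideanSpace ℝ (Fin n) → EuclideanSpace ℝ (Fin n))
    (f : EuclideanSpace ℝ (Fin n) → ℝ) : Prop :=
  MemSobolev U p u Du ∧
  ∃ (w : ℕ → EuclideanSpace ℝ (Fin n) → ℝ)
    (Dw : ℕ → EuclideanSpace ℝ (Fin n) → EuclideanSpace ℝ (Fin n)),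
    (∀ k, MemSobolev U p (w k) (Dw k) ∧ ContinuousOn (w k) (closure U)) ∧
    Tendsto (fun k => eLpNorm (w k - u) (ENNReal.ofReal p) (volume.restrict U)) atTop (𝓝 0) ∧
    Tendsto (fun k => eLpNorm (Dw k - Du) (ENNReal.ofReal p) (volume.restrict U)) atTop (𝓝 0) ∧
    Tendsto (fun k => eLpNorm (w k - f) (ENNReal.ofReal p) (surfaceMeasure Ω)) atTop (𝓝 0)

/-! A conductivity is a function `σ x E` of the point `x` and of the field strength `E > 0`, with
values in `[0, ∞]`; the value `0` describes a perfect insulator, `∞` a perfect conductor. Values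
at `E ≤ 0` play no role. -/

/-- `σ` is a Carathéodory function on `U`. -/
def IsCaratheodoryOn {n : ℕ} (U : Set (EuclideanSpace ℝ (Fin n)))
    (σ : EuclideanSpace ℝ (Fin n) → ℝ → ℝ≥0∞) : Prop :=
  (∀ E : ℝ, 0 < E → AEMeasurable (fun x => σ x E) (volume.restrict U)) ∧
  ∀ᵐ x ∂(volume.restrict U), ContinuousOn (σ x) (Set.Ioi 0)

/-- The `p`-growth condition on `U` with constants `lo ≤ hi` and reference field `E₀`. -/
def HasGrowthOn {n : ℕ} (U : Set (EuclideanSpace ℝ (Fin n))) (p lo hi E₀ : ℝ)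
    (σ : EuclideanSpace ℝ (Fin n) → ℝ → ℝ≥0∞) : Prop :=
  ∀ᵐ x ∂(volume.restrict U), ∀ E : ℝ, 0 < E →
    ENNReal.ofReal (lo * (E / E₀) ^ (p - 2)) ≤ σ x E ∧
    (2 ≤ p → σ x E ≤ ENNReal.ofReal (hi * (1 + (E / E₀) ^ (p - 2)))) ∧
    (p < 2 → σ x E ≤ ENNReal.ofReal (hi * (E / E₀) ^ (p - 2)))

/-- The vector field `σ(x, |v|) v`; it vanishes at `v = 0`. -/
def flux {n : ℕ} (σ : EuclideanSpace ℝ (Fin n) → ℝ → ℝ≥0∞) (x v : EuclideanSpace ℝ (Fin n)) :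
    EuclideanSpace ℝ (Fin n) :=
  (σ x ‖v‖).toReal • v

/-- The strong monotonicity condition with exponent `p` on `U`. -/
def HasStrongMonotonicityOn {n : ℕ} (U : Set (EuclideanSpace ℝ (Fin n))) (p : ℝ)
    (σ : EuclideanSpace ℝ (Fin n) → ℝ → ℝ≥0∞) : Prop :=
  ∃ κ : ℝ, 0 < κ ∧ ∀ᵐ x ∂(volume.restrict U), ∀ v₁ v₂ : EuclideanSpace ℝ (Fin n),
    (2 ≤ p → κ * ‖v₂ - v₁‖ ^ p ≤ inner ℝ (flux σ x v₂ - flux σ x v₁) (v₂ - v₁)) ∧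
    (p < 2 → κ * (1 + ‖v₂‖ ^ 2 + ‖v₁‖ ^ 2) ^ ((p - 2) / 2) * ‖v₂ - v₁‖ ^ 2
      ≤ inner ℝ (flux σ x v₂ - flux σ x v₁) (v₂ - v₁))

/-- The material in `A` is a perfect electrical insulator. -/
def IsPEI {n : ℕ} (A : Set (EuclideanSpace ℝ (Fin n)))
    (σ : EuclideanSpace ℝ (Fin n) → ℝ → ℝ≥0∞) : Prop :=
  ∀ᵐ x ∂(volume.restrict A), ∀ E : ℝ, 0 < E → σ x E = 0

/-- The material in `A` is a perfect electrical conductor. -/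
def IsPEC {n : ℕ} (A : Set (EuclideanSpace ℝ (Fin n)))
    (σ : EuclideanSpace ℝ (Fin n) → ℝ → ℝ≥0∞) : Prop :=
  ∀ᵐ x ∂(volume.restrict A), ∀ E : ℝ, 0 < E → σ x E = ∞

/-- The Dirichlet energy density `Q(x, E) = ∫₀ᴱ σ(x, ξ) ξ dξ`. -/
def energyDensity {n : ℕ} (σ : EuclideanSpace ℝ (Fin n) → ℝ → ℝ≥0∞)
    (x : EuclideanSpace ℝ (Fin n)) (E : ℝ) : ℝ≥0∞ :=
  ∫⁻ ξ in Set.Ioc 0 E, σ x ξ * ENNReal.ofReal ξ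

/-- The Dirichlet energy over `U` of a function with gradient `Du`. -/
def energyOn {n : ℕ} (U : Set (EuclideanSpace ℝ (Fin n)))
    (σ : EuclideanSpace ℝ (Fin n) → ℝ → ℝ≥0∞)
    (Du : EuclideanSpace ℝ (Fin n) → EuclideanSpace ℝ (Fin n)) : ℝ≥0∞ :=
  ∫⁻ x in U, energyDensity σ x ‖Du x‖

/-- Competitors of the two-phase problem: `u ∈ W^{1,p}(Ω) ∪ W^{1,q}(Ω)` with `u = f` on `∂Ω`. -/
def IsTwoPhaseCompetitor {n : ℕ} (Ω : Set (EuclideanSpace ℝ (Fin n))) (p q : ℝ)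
    (f u : EuclideanSpace ℝ (Fin n) → ℝ)
    (Du : EuclideanSpace ℝ (Fin n) → EuclideanSpace ℝ (Fin n)) : Prop :=
  HasTrace Ω Ω p u Du f ∨ HasTrace Ω Ω q u Du f

/-- `u`, with weak gradient `Du`, minimizes the two-phase Dirichlet energy. -/
def IsTwoPhaseMinimizer {n : ℕ} (Ω A : Set (EuclideanSpace ℝ (Fin n))) (p q : ℝ)
    (σ : EuclideanSpace ℝ (Fin n) → ℝ → ℝ≥0∞) (f u : EuclideanSpace ℝ (Fin n) → ℝ)
    (Du : EuclideanSpace ℝ (Fin n) → EuclideanSpace ℝ (Fin n)) : Prop :=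
  IsTwoPhaseCompetitor Ω p q f u Du ∧
  ∀ v Dv, IsTwoPhaseCompetitor Ω p q f v Dv →
    energyOn (outerPhase Ω A) σ Du + energyOn A σ Du ≤
      energyOn (outerPhase Ω A) σ Dv + energyOn A σ Dv

/-- `u`, with weak gradient `Du`, minimizes the Dirichlet energy over the outer region `B` among
the functions of `W^{1,p}(B)` with `u = f` on `∂Ω`. -/
def IsPEIMinimizer {n : ℕ} (Ω A : Set (EuclideanSpace ℝ (Fin n))) (p : ℝ)
    (σ : EuclideanSpace ℝ (Fin n) → ℝ → ℝ≥0∞) (f u : EuclideanSpace ℝ (Fin n) → ℝ)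
    (Du : EuclideanSpace ℝ (Fin n) → EuclideanSpace ℝ (Fin n)) : Prop :=
  HasTrace (outerPhase Ω A) Ω p u Du f ∧
  ∀ v Dv, HasTrace (outerPhase Ω A) Ω p v Dv f →
    energyOn (outerPhase Ω A) σ Du ≤ energyOn (outerPhase Ω A) σ Dv

/-- Competitors of the problem with a perfect conductor: `u ∈ W^{1,p}(Ω)` with `u = f` on `∂Ω`
and `∇u = 0` a.e. in `A`. -/
def IsPECCompetitor {n : ℕ} (Ω A : Set (EuclideanSpace ℝ (Fin n))) (p : ℝ)
    (f u : EuclideanSpace ℝ (Fin n) → ℝ)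
    (Du : EuclideanSpace ℝ (Fin n) → EuclideanSpace ℝ (Fin n)) : Prop :=
  HasTrace Ω Ω p u Du f ∧ ∀ᵐ x ∂(volume.restrict A), Du x = 0

/-- `u`, with weak gradient `Du`, minimizes the Dirichlet energy over the outer region among
the competitors with zero gradient in `A`. -/
def IsPECMinimizer {n : ℕ} (Ω A : Set (EuclideanSpace ℝ (Fin n))) (p : ℝ)
    (σ : EuclideanSpace ℝ (Fin n) → ℝ → ℝ≥0∞) (f u : EuclideanSpace ℝ (Fin n) → ℝ)
    (Du : EuclideanSpace ℝ (Fin n) → EuclideanSpace ℝ (Fin n)) : Prop :=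
  IsPECCompetitor Ω A p f u Du ∧
  ∀ v Dv, IsPECCompetitor Ω A p f v Dv →
    energyOn (outerPhase Ω A) σ Du ≤ energyOn (outerPhase Ω A) σ Dv

/-- The `L^p(U)` norm of a vector field. -/
def gradNorm {n : ℕ} (U : Set (EuclideanSpace ℝ (Fin n))) (p : ℝ)
    (Du : EuclideanSpace ℝ (Fin n) → EuclideanSpace ℝ (Fin n)) : ℝ≥0∞ :=
  eLpNorm Du (ENNReal.ofReal p) (volume.restrict U)

end

/-! All four estimates come from testing minimality against one competitor that does not depend on
`σ`: an extension `F` of `f` with `‖∇F‖_{L^p(Ω)} ≤ C ‖f‖_{X^p}` whose gradient vanishes at distance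
at least `δ` from `∂Ω`. Integrating the growth bounds gives energy at least `c ‖∇u‖^p` and at most
`C (|Ω| + ‖∇F‖^p)` on the region with exponent `p`, so the minimizer inherits the bound of `F`.
Since `∇F = 0` on an inclusion at distance at least `δ`, `F` has no energy there, whatever `q` is,
and it satisfies the constraint for a perfect conductor. For an insulator the restriction of `F` to
the outer region is admissible without any condition on the distance.

The extension (`exists_extension`) is built without flattening the boundary. With `d` the distance
to `∂Ω`, `F(x)` is a cutoff in `d(x)` times the average of `f` over `∂Ω` against the kernel `(ρ + |x
- y|)⁻ᴹ`, normalized to mass one, at scale `ρ = d(x)`. The geometry enters through finiteness of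
`dS` and the lower bound `dS(ball(y, r)) ≥ c r^(n-1)` (`exists_surfaceMeasure_ball_ge`), which
bounds the normalized kernel.

A displacement `h` changes the kernel by a relative amount `O(h/ρ)`, so up to the cutoff term `|∇F|
≤ C ρ⁻¹ ∫ k |f - F(x)|`. Jensen's inequality, used twice, and `kernel_bound_mul_le` bound the `p`-th
power by a double integral of `(|y - z| + |x - y|)^(-(p + 2(n-1))) |f(y) - f(z)|^p`. Integrating in
`x` over the whole space leaves `|y - z|^(-(n-1+p-1))`, the Slobodeckij kernel.

For the trace, the scale is replaced by `max(d, ε)`. These functions are Lipschitz up to the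
boundary, have a majorant independent of `ε`, and equal `F` where `d > ε`, so they converge to `F`
in `W^{1,p}`. On `∂Ω` they are averages at scale `ε`, whose distance to `f` has `p`-th power at most
`C ε^(p-1) ‖f‖_{X^p}^p`. -/

noncomputable section

/-! ### The surface measure of a bounded Lipschitz open set -/

/-- Coordinates on the hyperplane orthogonal to a unit vector. -/
theorem exists_hyperplane_coordinates {n : ℕ} (hn : 1 ≤ n) (e : EuclideanSpace ℝ (Fin n))
    (he : ‖e‖ = 1) :
    ∃ (ι : EuclideanSpace ℝ (Fin (n - 1)) →ₗᵢ[ℝ] EuclideanSpace ℝ (Fin n))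
      (π : EuclideanSpace ℝ (Fin n) →L[ℝ] EuclideanSpace ℝ (Fin (n - 1))),
      LipschitzWith 1 π ∧ (∀ z, π (ι z) = z) ∧ π e = 0 ∧
      (∀ x, ι (π x) = x - inner ℝ e x • e) ∧ ∀ z, inner ℝ e (ι z) = 0 := by
  have : Fact (Module.finrank ℝ (EuclideanSpace ℝ (Fin n)) = (n - 1) + 1) :=
    ⟨by simp; omega⟩
  have he0 : e ≠ 0 := by rintro rfl; simp at he
  let b := OrthonormalBasis.fromOrthogonalSpanSingleton (𝕜 := ℝ) (n - 1) he0
  let H : Submodule ℝ (EuclideanSpace ℝ (Fin n)) := (Submodule.span ℝ {e})ᗮ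
  let ι : EuclideanSpace ℝ (Fin (n - 1)) →ₗᵢ[ℝ] EuclideanSpace ℝ (Fin n) :=
    H.subtypeₗᵢ.comp b.repr.symm.toLinearIsometry
  let π : EuclideanSpace ℝ (Fin n) →L[ℝ] EuclideanSpace ℝ (Fin (n - 1)) :=
    (b.repr.toContinuousLinearEquiv : H →L[ℝ] EuclideanSpace ℝ (Fin (n - 1))).comp
      H.orthogonalProjectionOnto
  have hι : ∀ z, inner ℝ e (ι z) = 0 := fun z =>
    (Submodule.mem_orthogonal_singleton_iff_inner_right).1 (b.repr.symm z).2
  have hπ : ∀ x, ι (π x) = x - inner ℝ e x • e := by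
    intro x
    have h1 : ι (π x) = (H.orthogonalProjectionOnto x : EuclideanSpace ℝ (Fin n)) := by
      simp [ι, π]
    rw [h1, Submodule.coe_orthogonalProjectionOnto_apply, Submodule.starProjection_orthogonal_val,
      Submodule.starProjection_unit_singleton ℝ he]
  refine ⟨ι, π, ?_, ?_, ?_, hπ, hι⟩
  · refine LipschitzWith.of_dist_le_mul fun x y => ?_
    rw [NNReal.coe_one, one_mul, dist_eq_norm, dist_eq_norm, ← map_sub]
    have : ‖π (x - y)‖ = ‖H.orthogonalProjectionOnto (x - y)‖ := by
      simp only [π, ContinuousLinearMap.comp_apply]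
      exact b.repr.norm_map _
    rw [this]
    exact H.norm_orthogonalProjectionOnto_apply_le _
  · intro z
    apply ι.injective
    rw [hπ, hι]; simp
  · apply ι.injective
    rw [hπ]; simp [he]

theorem euclideanHausdorffMeasure_image_le {X Y : Type*} [EMetricSpace X] [MeasurableSpace X]
    [BorelSpace X] [EMetricSpace Y] [MeasurableSpace Y] [BorelSpace Y] {K : ℝ≥0} {f : X → Y}
    (h : LipschitzWith K f) (d : ℕ) (s : Set X) :
    Measure.euclideanHausdorffMeasure d (f '' s)
      ≤ (K : ℝ≥0∞) ^ d * Measure.euclideanHausdorffMeasure d s := by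
  rw [Measure.euclideanHausdorffMeasure_def, Measure.euclideanHausdorffMeasure_def]
  simp only [Measure.smul_apply, ENNReal.smul_def, smul_eq_mul]
  rw [mul_left_comm]
  gcongr
  simpa using h.hausdorffMeasure_image_le (d := d) (by positivity) s

section SurfaceMeasure

variable {n : ℕ}

/-- Near each boundary point, the boundary is a Lipschitz graph. -/
theorem exists_boundary_parametrization (hn : 1 ≤ n) {U : Set (EuclideanSpace ℝ (Fin n))}
    (hU : IsBoundedLipschitzOpen U) {x₀ : EuclideanSpace ℝ (Fin n)} (hx₀ : x₀ ∈ frontier U) :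
    ∃ (Γ : EuclideanSpace ℝ (Fin (n - 1)) → EuclideanSpace ℝ (Fin n))
      (π : EuclideanSpace ℝ (Fin n) → EuclideanSpace ℝ (Fin (n - 1))) (L : ℝ≥0) (R : ℝ),
      0 < R ∧ 0 < L ∧ LipschitzWith L Γ ∧ LipschitzWith 1 π ∧ (∀ z, π (Γ z) = z) ∧
      (∀ y ∈ frontier U ∩ Metric.ball x₀ R, Γ (π y) = y) ∧
      ∀ z, Γ z ∈ Metric.ball x₀ R → Γ z ∈ frontier U := by
  obtain ⟨e, γ, K, R, he, hγ, hR, hloc⟩ := hU.locally_graph x₀ hx₀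
  obtain ⟨ι, π, hπL, hπι, hπe, hιπ, hιe⟩ := exists_hyperplane_coordinates hn e he
  set Γ : EuclideanSpace ℝ (Fin (n - 1)) → EuclideanSpace ℝ (Fin n) :=
    fun z => ι z + γ (ι z) • e with hΓ
  have hee : inner ℝ e e = (1 : ℝ) := by rw [real_inner_self_eq_norm_sq, he]; norm_num
  have hΓL : LipschitzWith (1 + K) Γ := by
    refine LipschitzWith.of_dist_le_mul fun z w => ?_
    have h1 : dist (ι z) (ι w) = dist z w := ι.isometry.dist_eq z w
    have h2 : |γ (ι z) - γ (ι w)| ≤ K * dist z w := by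
      rw [← h1, ← Real.dist_eq]; exact hγ.dist_le_mul _ _
    calc dist (Γ z) (Γ w) ≤ dist (ι z) (ι w) + dist (γ (ι z) • e) (γ (ι w) • e) :=
          dist_add_add_le _ _ _ _
      _ = dist z w + |γ (ι z) - γ (ι w)| := by
          rw [h1, dist_eq_norm (γ (ι z) • e), ← sub_smul, norm_smul, he, mul_one, Real.norm_eq_abs]
      _ ≤ dist z w + K * dist z w := by gcongr
      _ = ((1 + K : ℝ≥0) : ℝ) * dist z w := by push_cast; ring
  have hπΓ : ∀ z, π (Γ z) = z := fun z => by simp [hΓ, hπι, hπe]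
  have hinnΓ : ∀ z, inner ℝ e (Γ z) = γ (ι z) := fun z => by
    simp [hΓ, inner_add_right, hιe, inner_smul_right, he]
  have hcont : Continuous fun x : EuclideanSpace ℝ (Fin n) =>
      inner ℝ e x - γ (x - inner ℝ e x • e) := by
    have := hγ.continuous
    fun_prop
  -- frontier points are on the graph
  have hgraph : ∀ y ∈ frontier U ∩ Metric.ball x₀ R, Γ (π y) = y := by
    rintro y ⟨hyf, hyb⟩
    have hyU : y ∉ U := by
      rw [hU.isOpen.frontier_eq] at hyf; exact hyf.2
    have hle : inner ℝ e y ≤ γ (y - inner ℝ e y • e) := not_lt.1 fun h => hyU ((hloc y hyb).2 h)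
    have hge : γ (y - inner ℝ e y • e) ≤ inner ℝ e y := by
      -- A point strictly below the graph has a neighbourhood below it, hence outside `U`, and
      -- cannot be in the closure.
      by_contra! hlt
      have hev : ∀ᶠ x in 𝓝 y, inner ℝ e x - γ (x - inner ℝ e x • e) < 0 :=
        hcont.continuousAt.eventually_lt continuousAt_const (by linarith)
      have hev2 : ∀ᶠ x in 𝓝 y, x ∉ U := by
        filter_upwards [hev, Metric.isOpen_ball.mem_nhds hyb] with x hx hxb hxU
        have := (hloc x hxb).1 hxU
        linarith
      have : y ∈ closure U := frontier_subset_closure hyf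
      obtain ⟨x, hx1, hx2⟩ := (mem_closure_iff_frequently.1 this).and_eventually hev2 |>.exists
      exact hx2 hx1
    have h := le_antisymm hle hge
    simp only [hΓ]
    rw [hιπ, ← h]; abel
  -- graph points are frontier points
  have hfront : ∀ z, Γ z ∈ Metric.ball x₀ R → Γ z ∈ frontier U := by
    intro z hz
    have hproj : ∀ t : ℝ, (Γ z + t • e) - inner ℝ e (Γ z + t • e) • e = ι z := by
      intro t
      rw [inner_add_right, hinnΓ, inner_smul_right, hee, add_smul]
      simp [hΓ]
    rw [hU.isOpen.frontier_eq]
    refine ⟨?_, ?_⟩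
    -- Moving up along `e` keeps the projection fixed and enters `U` at once, so the graph point is
    -- a limit of points of `U`.
    · have htend : Tendsto (fun t : ℝ => Γ z + t • e) (𝓝[>] 0) (𝓝 (Γ z)) := by
        have : Continuous fun t : ℝ => Γ z + t • e := by fun_prop
        have h := this.tendsto 0
        simp only [zero_smul, add_zero] at h
        exact h.mono_left nhdsWithin_le_nhds
      refine mem_closure_of_tendsto htend ?_
      filter_upwards [htend.eventually (Metric.isOpen_ball.mem_nhds hz), self_mem_nhdsWithin]
        with t ht htpos
      rw [hloc _ ht, hproj, inner_add_right, hinnΓ, inner_smul_right, hee, mul_one]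
      have : 0 < t := htpos
      linarith
    · rw [hloc _ hz]
      have := hproj 0
      simp only [zero_smul, add_zero] at this
      rw [this, hinnΓ]
      exact lt_irrefl _
  exact ⟨Γ, π, 1 + K, R, hR, by positivity, hΓL, hπL, hπΓ, hgraph, hfront⟩

/-- Near each boundary point, the surface measure is finite and bounded below by a power. -/
theorem surfaceMeasure_local (hn : 1 ≤ n) {U : Set (EuclideanSpace ℝ (Fin n))}
    (hU : IsBoundedLipschitzOpen U) {x₀ : EuclideanSpace ℝ (Fin n)} (hx₀ : x₀ ∈ frontier U) :
    ∃ (r₀ c : ℝ), 0 < r₀ ∧ 0 < c ∧ surfaceMeasure U (Metric.ball x₀ r₀) < ∞ ∧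
      ∀ y ∈ frontier U ∩ Metric.ball x₀ r₀, ∀ r, 0 < r → r ≤ r₀ →
        ENNReal.ofReal (c * r ^ (n - 1)) ≤ surfaceMeasure U (Metric.ball y r) := by
  obtain ⟨Γ, π, L, R, hR, hL, hΓL, hπL, hπΓ, hgraph, hfront⟩ :=
    exists_boundary_parametrization hn hU hx₀
  have hvol : ∀ (z : EuclideanSpace ℝ (Fin (n - 1))) (r : ℝ), 0 < r →
      Measure.euclideanHausdorffMeasure (n - 1) (Metric.ball z r)
        = ENNReal.ofReal (r ^ (n - 1)) * volume (Metric.ball (0 : EuclideanSpace ℝ (Fin (n - 1))) 1) := by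
    intro z r hr
    rw [EuclideanSpace.euclideanHausdorffMeasure_eq_volume, Measure.addHaar_ball_of_pos _ _ hr]
    simp
  set ω := volume (Metric.ball (0 : EuclideanSpace ℝ (Fin (n - 1))) 1) with hω
  have hω0 : 0 < ω := Metric.measure_ball_pos _ _ one_pos
  have hωt : ω < ∞ := measure_ball_lt_top
  have hK : (0 : ℝ) < L := by exact_mod_cast hL
  -- With `R / 2`, balls of radius at most `R / 2` centred within `R / 2` of `x₀` stay inside the
  -- chart. The lower constant is the volume of a ball of radius `1 / L`.
  refine ⟨R / 2, ω.toReal / L ^ (n - 1), by positivity,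
    div_pos (ENNReal.toReal_pos hω0.ne' hωt.ne) (by positivity), ?_, ?_⟩
  · rw [surfaceMeasure, Measure.restrict_apply measurableSet_ball]
    have hsub : Metric.ball x₀ (R / 2) ∩ frontier U ⊆ Γ '' Metric.ball (π x₀) R := by
      rintro y ⟨hyb, hyf⟩
      have hyb' : y ∈ Metric.ball x₀ R := Metric.ball_subset_ball (by linarith) hyb
      refine ⟨π y, ?_, hgraph y ⟨hyf, hyb'⟩⟩
      rw [Metric.mem_ball]
      calc dist (π y) (π x₀) ≤ (1 : ℝ≥0) * dist y x₀ := hπL.dist_le_mul _ _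
        _ < R := by simpa using hyb'
    refine (measure_mono hsub).trans_lt
      ((euclideanHausdorffMeasure_image_le hΓL (n - 1) _).trans_lt ?_)
    rw [hvol _ _ hR]
    exact ENNReal.mul_lt_top (by finiteness) (ENNReal.mul_lt_top ENNReal.ofReal_lt_top hωt)
  · rintro y ⟨hyf, hyb⟩ r hr hrR
    rw [surfaceMeasure, Measure.restrict_apply measurableSet_ball]
    have hyb' : y ∈ Metric.ball x₀ R := Metric.ball_subset_ball (by linarith) hyb
    -- The 1-Lipschitz projection does not increase measure, and the boundary piece projects onto a
    -- set containing a flat ball of radius `r / L`.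
    have hsub : Metric.ball (π y) (r / L) ⊆ π '' (Metric.ball y r ∩ frontier U) := by
      intro z hz
      have h1 : Γ z ∈ Metric.ball y r := by
        rw [Metric.mem_ball]
        calc dist (Γ z) y = dist (Γ z) (Γ (π y)) := by rw [hgraph y ⟨hyf, hyb'⟩]
          _ ≤ (L : ℝ) * dist z (π y) := hΓL.dist_le_mul _ _
          _ < L * (r / L) := by
            exact mul_lt_mul_of_pos_left hz hK
          _ = r := by field_simp
      refine ⟨Γ z, ⟨h1, hfront z ?_⟩, hπΓ z⟩
      rw [Metric.mem_ball] at h1 hyb ⊢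
      linarith [dist_triangle (Γ z) y x₀]
    have := (measure_mono hsub).trans (euclideanHausdorffMeasure_image_le hπL (n - 1) _)
    rw [hvol _ _ (by positivity)] at this
    simp only [ENNReal.coe_one, one_pow, one_mul] at this
    refine le_trans (le_of_eq ?_) this
    rw [← ENNReal.ofReal_toReal hωt.ne, ← ENNReal.ofReal_mul (by positivity),
      ENNReal.ofReal_toReal hωt.ne]
    congr 1
    rw [div_pow]; ring

theorem isCompact_frontier_of_isBounded {U : Set (EuclideanSpace ℝ (Fin n))}
    (hU : Bornology.IsBounded U) : IsCompact (frontier U) :=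
  hU.isCompact_closure.of_isClosed_subset isClosed_frontier frontier_subset_closure

theorem isFiniteMeasure_surfaceMeasure (hn : 1 ≤ n) {U : Set (EuclideanSpace ℝ (Fin n))}
    (hU : IsBoundedLipschitzOpen U) : IsFiniteMeasure (surfaceMeasure U) := by
  constructor
  have h : surfaceMeasure U (frontier U) < ∞ := by
    refine (isCompact_frontier_of_isBounded hU.isBounded).measure_lt_top_of_nhdsWithin
      fun x hx => ?_
    obtain ⟨r, c, hr, -, hfin, -⟩ := surfaceMeasure_local hn hU hx
    exact ⟨_, mem_nhdsWithin_of_mem_nhds (Metric.ball_mem_nhds x hr), hfin⟩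
  refine lt_of_le_of_lt (le_of_eq ?_) h
  rw [surfaceMeasure, Measure.restrict_apply_univ,
    Measure.restrict_apply isClosed_frontier.measurableSet, Set.inter_self]

/-- The surface measure is lower Ahlfors regular. -/
theorem exists_surfaceMeasure_ball_ge (hn : 1 ≤ n) {U : Set (EuclideanSpace ℝ (Fin n))}
    (hU : IsBoundedLipschitzOpen U) (R : ℝ) :
    ∃ c : ℝ, 0 < c ∧ ∀ y ∈ frontier U, ∀ r, 0 < r → r ≤ R →
      ENNReal.ofReal (c * r ^ (n - 1)) ≤ surfaceMeasure U (Metric.ball y r) := by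
  have key : ∃ r₀ c : ℝ, 0 < r₀ ∧ 0 < c ∧ ∀ y ∈ frontier U, ∀ r, 0 < r → r ≤ r₀ →
      ENNReal.ofReal (c * r ^ (n - 1)) ≤ surfaceMeasure U (Metric.ball y r) := by
    refine (isCompact_frontier_of_isBounded hU.isBounded).induction_on
      (p := fun s => ∃ r₀ c : ℝ, 0 < r₀ ∧ 0 < c ∧ ∀ y ∈ s, ∀ r, 0 < r → r ≤ r₀ →
        ENNReal.ofReal (c * r ^ (n - 1)) ≤ surfaceMeasure U (Metric.ball y r))
      ⟨1, 1, one_pos, one_pos, by simp⟩ ?_ ?_ ?_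
    · rintro s t hst ⟨r₀, c, hr, hc, h⟩
      exact ⟨r₀, c, hr, hc, fun y hy => h y (hst hy)⟩
    · rintro s t ⟨r₁, c₁, hr₁, hc₁, h₁⟩ ⟨r₂, c₂, hr₂, hc₂, h₂⟩
      refine ⟨min r₁ r₂, min c₁ c₂, lt_min hr₁ hr₂, lt_min hc₁ hc₂, ?_⟩
      rintro y (hy | hy) r hr hle
      · refine le_trans (ENNReal.ofReal_le_ofReal ?_) (h₁ y hy r hr (hle.trans (min_le_left _ _)))
        gcongr; exact min_le_left _ _
      · refine le_trans (ENNReal.ofReal_le_ofReal ?_) (h₂ y hy r hr (hle.trans (min_le_right _ _)))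
        gcongr; exact min_le_right _ _
    · intro x hx
      obtain ⟨r, c, hr, hc, -, h⟩ := surfaceMeasure_local hn hU hx
      exact ⟨frontier U ∩ Metric.ball x r,
        inter_mem_nhdsWithin _ (Metric.ball_mem_nhds x hr), r, c, hr, hc, h⟩
  obtain ⟨r₀, c, hr₀, hc, h⟩ := key
  -- Larger radii are shrunk by the factor `r₀ / R'`, which costs only a constant.
  set R' := max R r₀
  have hR' : 0 < R' := lt_max_of_lt_right hr₀
  have hq : r₀ / R' ≤ 1 := (div_le_one hR').2 (le_max_right _ _)
  refine ⟨c * (r₀ / R') ^ (n - 1), by positivity, fun y hy r hr hrR => ?_⟩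
  have hs : r₀ / R' * r ≤ r₀ := by
    rw [div_mul_eq_mul_div, div_le_iff₀ hR']
    gcongr; exact hrR.trans (le_max_left _ _)
  calc ENNReal.ofReal (c * (r₀ / R') ^ (n - 1) * r ^ (n - 1))
      = ENNReal.ofReal (c * (r₀ / R' * r) ^ (n - 1)) := by rw [mul_pow, mul_assoc]
    _ ≤ surfaceMeasure U (Metric.ball y (r₀ / R' * r)) := h y hy _ (by positivity) hs
    _ ≤ surfaceMeasure U (Metric.ball y r) :=
      measure_mono (Metric.ball_subset_ball (mul_le_of_le_one_left hr.le hq))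

end SurfaceMeasure

/-! ### Averages with a polynomially decaying kernel -/

/-- Jensen's inequality for a probability density. -/
theorem rpow_lintegral_mul_le {α : Type*} [MeasurableSpace α] {μ : Measure α} {k g : α → ℝ≥0∞}
    (hk : AEMeasurable k μ) (hg : AEMeasurable g μ) (hk1 : ∫⁻ y, k y ∂μ = 1)
    {p : ℝ} (hp : 1 ≤ p) :
    (∫⁻ y, k y * g y ∂μ) ^ p ≤ ∫⁻ y, k y * g y ^ p ∂μ := by
  have hp0 : 0 < p := by linarith
  have hp1 : 1 / p ≤ 1 := (div_le_one hp0).2 hp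
  -- Hölder for the splitting `k g = (k g^p)^(1/p) k^(1-1/p)`; the second factor has integral one.
  have h := ENNReal.lintegral_mul_norm_pow_le (μ := μ) (f := fun y => k y * g y ^ p) (g := k)
    (hk.mul (hg.pow_const p)) hk (p := 1 / p) (q := 1 - 1 / p) (by positivity) (by linarith)
    (by ring)
  rw [hk1, ENNReal.one_rpow, mul_one] at h
  have h2 : ∀ y, (k y * g y ^ p) ^ (1 / p) * k y ^ (1 - 1 / p) = k y * g y := by
    intro y
    rw [ENNReal.mul_rpow_of_nonneg _ _ (by positivity), ← ENNReal.rpow_mul,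
      mul_one_div_cancel hp0.ne', ENNReal.rpow_one, mul_right_comm,
      ← ENNReal.rpow_add_of_nonneg _ _ (by positivity) (by linarith)]
    simp
  simp_rw [h2] at h
  calc _ ≤ ((∫⁻ y, k y * g y ^ p ∂μ) ^ (1 / p)) ^ p := by gcongr
    _ = _ := by rw [← ENNReal.rpow_mul, one_div_mul_cancel hp0.ne', ENNReal.rpow_one]

section Kernel

variable {X : Type*} [PseudoMetricSpace X]

/-- The kernel `(ρ + |x - y|)⁻ᴹ`. -/
def decayKernel (M : ℕ) (ρ : ℝ) (x y : X) : ℝ := ((ρ + dist x y) ^ M)⁻¹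

theorem decayKernel_pos (M : ℕ) {ρ : ℝ} (hρ : 0 < ρ) (x y : X) : 0 < decayKernel M ρ x y := by
  have : 0 ≤ dist x y := dist_nonneg
  unfold decayKernel; positivity

theorem decayKernel_le (M : ℕ) {ρ : ℝ} (hρ : 0 < ρ) (x y : X) :
    decayKernel M ρ x y ≤ (ρ ^ M)⁻¹ := by
  unfold decayKernel
  gcongr
  linarith [dist_nonneg (x := x) (y := y)]

theorem abs_inv_pow_sub_inv_pow_le (M : ℕ) {a b h : ℝ} (ha : 0 < a) (hb : |b - a| ≤ h)
    (hh : h ≤ a / 2) :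
    |(b ^ M)⁻¹ - (a ^ M)⁻¹| ≤ M * 2 ^ (M + 1) * (h / a) * (a ^ M)⁻¹ := by
  have hb' := abs_le.1 hb
  have hb0 : a / 2 ≤ b := by linarith
  have hbpos : 0 < b := by linarith
  have hr : a / b ≤ 2 := by rw [div_le_iff₀ hbpos]; linarith
  have hr0 : 0 < a / b := by positivity
  have e1 : (b ^ M)⁻¹ - (a ^ M)⁻¹ = ((a / b) ^ M - 1 ^ M) * (a ^ M)⁻¹ := by
    rw [div_pow, one_pow]; field_simp
  rw [e1, abs_mul, abs_of_pos (by positivity : 0 < (a ^ M)⁻¹)]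
  gcongr
  refine (abs_pow_sub_pow_le _ _ _).trans ?_
  have h1 : |a / b - 1| ≤ 2 * (h / a) := by
    have : a / b - 1 = (a - b) / b := by field_simp
    rw [this, abs_div, abs_of_pos hbpos, abs_sub_comm, div_le_iff₀ hbpos]
    have h0 : 0 ≤ h := (abs_nonneg _).trans hb
    calc |b - a| ≤ h := hb
      _ = 2 * (h / a) * (a / 2) := by field_simp
      _ ≤ 2 * (h / a) * b := by gcongr
  have h2 : max |a / b| |1| ^ (M - 1) ≤ 2 ^ M := by
    have : max |a / b| |(1 : ℝ)| ≤ 2 := by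
      rw [abs_of_pos hr0]; exact max_le hr (by norm_num)
    calc max |a / b| |1| ^ (M - 1) ≤ 2 ^ (M - 1) := by gcongr
      _ ≤ 2 ^ M := by gcongr <;> [norm_num; omega]
  have h0 : 0 ≤ 2 * (h / a) := (abs_nonneg _).trans h1
  calc |a / b - 1| * M * max |a / b| |1| ^ (M - 1) ≤ 2 * (h / a) * M * 2 ^ M := by gcongr
    _ = _ := by rw [pow_succ]; ring

/-- The base `ρ + dist x y` moves by at most the total displacement and is at least `ρ`, so the
relative change of the kernel is controlled by displacement over `ρ`, uniformly in `y`. -/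
theorem abs_decayKernel_sub_le (M : ℕ) {ρ ρ' : ℝ} (hρ : 0 < ρ) {x x' : X}
    (h : |ρ' - ρ| + dist x' x ≤ ρ / 2) (y : X) :
    |decayKernel M ρ' x' y - decayKernel M ρ x y|
      ≤ M * 2 ^ (M + 1) * ((|ρ' - ρ| + dist x' x) / ρ) * decayKernel M ρ x y := by
  have hd : 0 ≤ dist x y := dist_nonneg
  have h1 : |(ρ' + dist x' y) - (ρ + dist x y)| ≤ |ρ' - ρ| + dist x' x := by
    have e : (ρ' + dist x' y) - (ρ + dist x y) = (ρ' - ρ) + (dist x' y - dist x y) := by ring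
    rw [e]
    refine (abs_add_le _ _).trans ?_
    gcongr
    exact abs_dist_sub_le x' x y
  have h0 : 0 ≤ |ρ' - ρ| + dist x' x := by positivity
  refine (abs_inv_pow_sub_inv_pow_le M (by linarith) h1 (by linarith)).trans ?_
  unfold decayKernel
  gcongr
  linarith

theorem le_decayKernel (M : ℕ) {ρ ρ' : ℝ} (hρ : 0 < ρ) {x x' : X}
    (h : |ρ' - ρ| + dist x' x ≤ ρ / 2) (y : X) :
    (1 / 2) ^ M * decayKernel M ρ x y ≤ decayKernel M ρ' x' y := by
  have hd : 0 ≤ dist x y := dist_nonneg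
  have hd' : 0 ≤ dist x' y := dist_nonneg
  have h1 := abs_le.1 (abs_dist_sub_le x' x y)
  have h2 := abs_le.1 (show |ρ' - ρ| ≤ ρ / 2 by linarith [dist_nonneg (x := x') (y := x)])
  have h3 : ρ' - ρ ≤ |ρ' - ρ| := le_abs_self _
  unfold decayKernel
  rw [one_div, inv_pow, ← mul_inv, ← mul_pow]
  have : 0 < ρ' := by linarith
  gcongr
  linarith

variable [MeasurableSpace X] [OpensMeasurableSpace X] (S : Measure X)

theorem measurable_decayKernel (M : ℕ) (ρ : ℝ) (x : X) :
    Measurable (decayKernel M ρ x) := by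
  unfold decayKernel
  exact (((Continuous.measurable (by fun_prop : Continuous fun y => dist x y)).const_add _).pow_const _).inv

/-- The kernel, normalized to have integral one. -/
def avgKernel (M : ℕ) (ρ : ℝ) (x y : X) : ℝ :=
  decayKernel M ρ x y / ∫ z, decayKernel M ρ x z ∂S

/-- The average of `f` at scale `ρ` around `x`. -/
def kernelAvg (M : ℕ) (f : X → ℝ) (ρ : ℝ) (x : X) : ℝ := ∫ y, avgKernel S M ρ x y * f y ∂S

variable {S}

theorem integrable_decayKernel_mul {M : ℕ} {ρ : ℝ} (hρ : 0 < ρ) (x : X) {f : X → ℝ}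
    (hf : Integrable f S) : Integrable (fun y => decayKernel M ρ x y * f y) S := by
  refine hf.bdd_mul (c := (ρ ^ M)⁻¹) (measurable_decayKernel M ρ x).aestronglyMeasurable
    (ae_of_all _ fun y => ?_)
  rw [Real.norm_of_nonneg (decayKernel_pos M hρ x y).le]
  exact decayKernel_le M hρ x y

theorem measurable_avgKernel (M : ℕ) (ρ : ℝ) (x : X) : Measurable (avgKernel S M ρ x) :=
  (measurable_decayKernel M ρ x).div_const _

theorem integrable_avgKernel_mul {M : ℕ} {ρ : ℝ} (hρ : 0 < ρ) (x : X) {f : X → ℝ}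
    (hf : Integrable f S) : Integrable (fun y => avgKernel S M ρ x y * f y) S := by
  refine ((integrable_decayKernel_mul (M := M) hρ x hf).div_const
    (∫ z, decayKernel M ρ x z ∂S)).congr (ae_of_all _ fun y => ?_)
  simp only [avgKernel]; ring

variable [IsFiniteMeasure S]

theorem integrable_decayKernel {M : ℕ} {ρ : ℝ} (hρ : 0 < ρ) (x : X) :
    Integrable (decayKernel M ρ x) S := by
  simpa using integrable_decayKernel_mul (M := M) hρ x (integrable_const (μ := S) (1 : ℝ))

theorem integrable_avgKernel {M : ℕ} {ρ : ℝ} (hρ : 0 < ρ) (x : X) :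
    Integrable (avgKernel S M ρ x) S := (integrable_decayKernel hρ x).div_const _

theorem integral_decayKernel_pos [NeZero S] {M : ℕ} {ρ : ℝ} (hρ : 0 < ρ) (x : X) :
    0 < ∫ y, decayKernel M ρ x y ∂S := by
  rw [integral_pos_iff_support_of_nonneg (fun y => (decayKernel_pos M hρ x y).le)
    (integrable_decayKernel hρ x)]
  have : Function.support (decayKernel M ρ x) = Set.univ := by
    ext y; simp [(decayKernel_pos M hρ x y).ne']
  rw [this]
  exact Measure.measure_univ_pos.2 (NeZero.ne S)

theorem avgKernel_pos [NeZero S] (M : ℕ) {ρ : ℝ} (hρ : 0 < ρ) (x y : X) :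
    0 < avgKernel S M ρ x y :=
  div_pos (decayKernel_pos M hρ x y) (integral_decayKernel_pos hρ x)

theorem integral_avgKernel [NeZero S] (M : ℕ) {ρ : ℝ} (hρ : 0 < ρ) (x : X) :
    ∫ y, avgKernel S M ρ x y ∂S = 1 := by
  simp only [avgKernel]
  rw [integral_div, div_self (integral_decayKernel_pos hρ x).ne']

theorem lintegral_avgKernel [NeZero S] (M : ℕ) {ρ : ℝ} (hρ : 0 < ρ) (x : X) :
    ∫⁻ y, ENNReal.ofReal (avgKernel S M ρ x y) ∂S = 1 := by
  rw [← ofReal_integral_eq_lintegral_ofReal (integrable_avgKernel hρ x)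
    (ae_of_all _ fun y => (avgKernel_pos M hρ x y).le), integral_avgKernel M hρ x]
  simp

theorem integral_avgKernel_mul_sub [NeZero S] {M : ℕ} {ρ : ℝ} (hρ : 0 < ρ) (x : X) {f : X → ℝ}
    (hf : Integrable f S) (a : ℝ) :
    ∫ y, avgKernel S M ρ x y * (a - f y) ∂S = a - kernelAvg S M f ρ x := by
  simp_rw [mul_sub]
  rw [integral_sub ((integrable_avgKernel hρ x).mul_const a) (integrable_avgKernel_mul hρ x hf),
    integral_mul_const, integral_avgKernel M hρ x, one_mul]
  rfl

/-- The kernel has mass one, so `a` minus the average is the average of `a - f`, to which Jensen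
applies. -/
theorem enorm_sub_kernelAvg_rpow_le [NeZero S] {M : ℕ} {ρ : ℝ} (hρ : 0 < ρ) (x : X) {f : X → ℝ}
    (hf : Integrable f S) (a : ℝ) {p : ℝ} (hp : 1 ≤ p) :
    ‖a - kernelAvg S M f ρ x‖ₑ ^ p
      ≤ ∫⁻ y, ENNReal.ofReal (avgKernel S M ρ x y) * ‖a - f y‖ₑ ^ p ∂S := by
  refine le_trans ?_ (rpow_lintegral_mul_le
    (measurable_avgKernel M ρ x).ennreal_ofReal.aemeasurable
    (aestronglyMeasurable_const.sub hf.aestronglyMeasurable).enorm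
    (lintegral_avgKernel M hρ x) hp)
  gcongr
  rw [← integral_avgKernel_mul_sub hρ x hf]
  refine (enorm_integral_le_lintegral_enorm _).trans (lintegral_mono fun y => ?_)
  rw [enorm_mul, Real.enorm_of_nonneg (avgKernel_pos M hρ x y).le]
  rfl

/-- The source of the gradient bound. Subtracting the average `w` first makes `f - w` orthogonal to
the old kernel, so only the difference of kernels acts on it; this difference is `O(displacement /
ρ)` times the old kernel. The two normalizations need only be comparable. -/
theorem abs_kernelAvg_sub_le [NeZero S] {M : ℕ} {ρ ρ' : ℝ} (hρ : 0 < ρ) {x x' : X}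
    (h : |ρ' - ρ| + dist x' x ≤ ρ / 2) {f : X → ℝ} (hf : Integrable f S) :
    |kernelAvg S M f ρ' x' - kernelAvg S M f ρ x|
      ≤ M * 2 ^ (2 * M + 1) * ((|ρ' - ρ| + dist x' x) / ρ)
        * ∫ y, avgKernel S M ρ x y * |f y - kernelAvg S M f ρ x| ∂S := by
  have hρ' : 0 < ρ' := by
    have := abs_le.1 (show |ρ' - ρ| ≤ ρ / 2 by linarith [dist_nonneg (x := x') (y := x)])
    linarith
  set w := kernelAvg S M f ρ x with hw
  set t := (|ρ' - ρ| + dist x' x) / ρ with ht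
  have ht0 : 0 ≤ t := by positivity
  set D := ∫ y, decayKernel M ρ x y ∂S with hD
  set D' := ∫ y, decayKernel M ρ' x' y ∂S with hD'
  have hDpos : 0 < D := integral_decayKernel_pos hρ x
  have hDpos' : 0 < D' := integral_decayKernel_pos hρ' x'
  have hfw : Integrable (fun y => f y - w) S := hf.sub (integrable_const w)
  have hDD' : (1 / 2) ^ M * D ≤ D' := by
    rw [hD, hD', ← integral_const_mul]
    exact integral_mono ((integrable_decayKernel hρ x).const_mul _)
      (integrable_decayKernel hρ' x') fun y => le_decayKernel M hρ h y
  have e1 : kernelAvg S M f ρ' x' - w = (∫ y, decayKernel M ρ' x' y * (f y - w) ∂S) / D' := by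
    have := integral_avgKernel_mul_sub (M := M) hρ' x' hf w
    rw [← neg_sub w, ← this, ← integral_neg, ← integral_div]
    congr 1; ext y; simp only [avgKernel]; ring
  -- The cancellation: `f - w` has mean zero against the kernel at `(ρ, x)`, even without
  -- normalization.
  have e2 : ∫ y, decayKernel M ρ x y * (f y - w) ∂S = 0 := by
    have := integral_avgKernel_mul_sub (M := M) hρ x hf w
    rw [← hw, sub_self] at this
    have e : ∀ y, decayKernel M ρ x y * (f y - w) = -D * (avgKernel S M ρ x y * (w - f y)) := by
      intro y; simp only [avgKernel]; rw [← hD]; field_simp; ring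
    simp_rw [e]
    rw [integral_const_mul, this, mul_zero]
  have e3 : ∫ y, decayKernel M ρ' x' y * (f y - w) ∂S
      = ∫ y, (decayKernel M ρ' x' y - decayKernel M ρ x y) * (f y - w) ∂S := by
    simp_rw [sub_mul]
    rw [integral_sub (integrable_decayKernel_mul hρ' x' hfw)
      (integrable_decayKernel_mul hρ x hfw), e2, sub_zero]
  have e4 : |∫ y, (decayKernel M ρ' x' y - decayKernel M ρ x y) * (f y - w) ∂S|
      ≤ M * 2 ^ (M + 1) * t * (D * ∫ y, avgKernel S M ρ x y * |f y - w| ∂S) := by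
    rw [← integral_const_mul D, ← integral_const_mul]
    have hi : Integrable (fun y => (M * 2 ^ (M + 1) * t) *
        (D * (avgKernel S M ρ x y * |f y - w|))) S :=
      ((integrable_avgKernel_mul hρ x hfw.abs).const_mul D).const_mul _
    rw [← Real.norm_eq_abs]
    refine norm_integral_le_of_norm_le hi (ae_of_all _ fun y => ?_)
    rw [norm_mul, Real.norm_eq_abs, Real.norm_eq_abs]
    have := abs_decayKernel_sub_le M hρ h y
    have e : D * (avgKernel S M ρ x y * |f y - w|) = decayKernel M ρ x y * |f y - w| := by
      simp only [avgKernel]; rw [← hD]; field_simp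
    rw [e, ← mul_assoc]
    gcongr
  have hI : 0 ≤ ∫ y, avgKernel S M ρ x y * |f y - w| ∂S :=
    integral_nonneg fun y => mul_nonneg (avgKernel_pos M hρ x y).le (abs_nonneg _)
  rw [e1, e3, abs_div, abs_of_pos hDpos', div_le_iff₀ hDpos']
  refine e4.trans ?_
  have : D ≤ 2 ^ M * D' := by
    calc D = 2 ^ M * ((1 / 2) ^ M * D) := by
          rw [← mul_assoc, ← mul_pow]; norm_num
      _ ≤ _ := by gcongr
  calc _ ≤ M * 2 ^ (M + 1) * t * ((2 ^ M * D') * ∫ y, avgKernel S M ρ x y * |f y - w| ∂S) := by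
        gcongr
    _ = _ := by
        rw [show 2 * M + 1 = (M + 1) + M by ring, pow_add 2 (M + 1) M]; ring

/-- Where the measure is bounded below, the normalized kernel is bounded above. -/
theorem avgKernel_le [NeZero S] (M m : ℕ) {ρ c : ℝ} (hρ : 0 < ρ) (hc : 0 < c) {x y₀ : X}
    (hxy : dist x y₀ ≤ ρ) (hS : ENNReal.ofReal (c * ρ ^ m) ≤ S (Metric.ball y₀ ρ)) (y : X) :
    avgKernel S M ρ x y ≤ 3 ^ M / c * (ρ ^ m)⁻¹ * (ρ / (ρ + dist x y)) ^ M := by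
  -- On the ball around `y₀`, `dist x y` is at most `2 * ρ`, so the kernel is at least `(3 * ρ)⁻ᴹ`
  -- there.
  have hD : c * ρ ^ m * ((3 * ρ) ^ M)⁻¹ ≤ ∫ y, decayKernel M ρ x y ∂S := by
    have h1 : c * ρ ^ m ≤ S.real (Metric.ball y₀ ρ) := by
      rw [Measure.real, ← ENNReal.ofReal_le_iff_le_toReal (measure_ne_top _ _)]
      exact hS
    calc c * ρ ^ m * ((3 * ρ) ^ M)⁻¹ ≤ S.real (Metric.ball y₀ ρ) * ((3 * ρ) ^ M)⁻¹ := by gcongr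
      _ = ∫ y in Metric.ball y₀ ρ, ((3 * ρ) ^ M)⁻¹ ∂S := by simp
      _ ≤ ∫ y in Metric.ball y₀ ρ, decayKernel M ρ x y ∂S := by
          refine setIntegral_mono_on (by simp) (integrable_decayKernel hρ x).integrableOn
            measurableSet_ball fun y hy => ?_
          unfold decayKernel
          have : 0 ≤ dist x y := dist_nonneg
          gcongr
          rw [Metric.mem_ball, dist_comm] at hy
          linarith [dist_triangle x y₀ y]
      _ ≤ ∫ y, decayKernel M ρ x y ∂S :=
          setIntegral_le_integral (integrable_decayKernel hρ x)
            (ae_of_all _ fun y => (decayKernel_pos M hρ x y).le)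
  have hd : 0 ≤ dist x y := dist_nonneg
  calc avgKernel S M ρ x y ≤ decayKernel M ρ x y / (c * ρ ^ m * ((3 * ρ) ^ M)⁻¹) := by
        unfold avgKernel
        have := (decayKernel_pos M hρ x y).le
        gcongr
    _ = _ := by
        unfold decayKernel
        rw [mul_pow, div_pow]
        have : ρ + dist x y ≠ 0 := by positivity
        field_simp

end Kernel

/-! ### Estimates for the normalized kernel and integrals of powers of the distance -/

theorem pow_div_add_le_rpow {ρ a α : ℝ} {M : ℕ} (hρ : 0 < ρ) (ha : 0 < a) (hα : 0 ≤ α)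
    (hM : α ≤ M) : (ρ / (ρ + a)) ^ M ≤ (ρ / a) ^ α := by
  have h1 : ρ / (ρ + a) ≤ 1 := (div_le_one (by positivity)).2 (by linarith)
  calc (ρ / (ρ + a)) ^ M = (ρ / (ρ + a)) ^ (M : ℝ) := (Real.rpow_natCast _ _).symm
    _ ≤ (ρ / (ρ + a)) ^ α := Real.rpow_le_rpow_of_exponent_ge (by positivity) h1 hM
    _ ≤ (ρ / a) ^ α := by gcongr; linarith

/-- Spending `m + (p - 1)` powers of decay produces the Slobodeckij kernel and leaves the gain
`ρ^(p-1)`, which makes the boundary averages converge to `f`. -/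
theorem kernel_bound_le_trace {ρ a p : ℝ} {M m : ℕ} (hρ : 0 < ρ) (ha : 0 < a) (hp : 1 ≤ p)
    (hM : p + 2 * m ≤ M) :
    (ρ ^ m)⁻¹ * (ρ / (ρ + a)) ^ M ≤ ρ ^ (p - 1) * (a ^ ((m : ℝ) + (p - 1)))⁻¹ := by
  have h := pow_div_add_le_rpow (M := M) (α := m + (p - 1)) hρ ha (by positivity [sub_nonneg.2 hp])
    (by have : (0 : ℝ) ≤ m := by positivity
        linarith)
  calc (ρ ^ m)⁻¹ * (ρ / (ρ + a)) ^ M ≤ (ρ ^ m)⁻¹ * (ρ / a) ^ ((m : ℝ) + (p - 1)) := by gcongr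
    _ = _ := by
      rw [Real.div_rpow hρ.le ha.le, Real.rpow_add hρ, Real.rpow_natCast]
      field_simp

theorem kernel_bound_le_pow {ρ a : ℝ} {M m : ℕ} (hρ : 0 < ρ) (ha : 0 < a) (hM : m ≤ M) :
    (ρ ^ m)⁻¹ * (ρ / (ρ + a)) ^ M ≤ (a ^ m)⁻¹ := by
  have h := pow_div_add_le_rpow (M := M) (α := m) hρ ha (by positivity) (by exact_mod_cast hM)
  calc (ρ ^ m)⁻¹ * (ρ / (ρ + a)) ^ M ≤ (ρ ^ m)⁻¹ * (ρ / a) ^ (m : ℝ) := by gcongr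
    _ = _ := by
      rw [Real.rpow_natCast, div_pow]
      field_simp

/-- Since `s + a ≤ 2 * a + b`, the larger of `a` and `b` is at least `(s + a) / 3`. All `p + 2m`
powers of decay are taken from its factor and the other factor is bounded by one; the powers of `ρ`
then cancel. This step dictates the size of `M`. -/
theorem kernel_bound_mul_le {ρ a b s p : ℝ} {M m : ℕ} (hρ : 0 < ρ) (ha : 0 < a) (hb : 0 < b)
    (hs : 0 ≤ s) (hsab : s ≤ a + b) (hp : 0 ≤ p) (hM : p + 2 * m ≤ M) :
    (ρ ^ p)⁻¹ * (((ρ ^ m)⁻¹ * (ρ / (ρ + a)) ^ M) * ((ρ ^ m)⁻¹ * (ρ / (ρ + b)) ^ M))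
      ≤ 3 ^ (p + 2 * m) * (s + a) ^ (-(p + 2 * m)) := by
  set N : ℝ := p + 2 * m
  have hN : 0 ≤ N := by positivity
  have h1 : (ρ / (ρ + a)) ^ M * (ρ / (ρ + b)) ^ M ≤ (3 * ρ / (s + a)) ^ N := by
    have ha1 : (ρ / (ρ + a)) ^ M ≤ 1 :=
      pow_le_one₀ (by positivity) ((div_le_one (by positivity)).2 (by linarith))
    have hb1 : (ρ / (ρ + b)) ^ M ≤ 1 :=
      pow_le_one₀ (by positivity) ((div_le_one (by positivity)).2 (by linarith))
    rcases le_total a b with hab | hab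
    · calc (ρ / (ρ + a)) ^ M * (ρ / (ρ + b)) ^ M ≤ 1 * (ρ / b) ^ N := by
            gcongr; exact pow_div_add_le_rpow hρ hb hN hM
        _ ≤ (3 * ρ / (s + a)) ^ N := by
            rw [one_mul]
            refine Real.rpow_le_rpow (by positivity) ?_ hN
            rw [div_le_div_iff₀ hb (by positivity)]
            nlinarith
    · calc (ρ / (ρ + a)) ^ M * (ρ / (ρ + b)) ^ M ≤ (ρ / a) ^ N * 1 := by
            gcongr; exact pow_div_add_le_rpow hρ ha hN hM
        _ ≤ (3 * ρ / (s + a)) ^ N := by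
            rw [mul_one]
            refine Real.rpow_le_rpow (by positivity) ?_ hN
            rw [div_le_div_iff₀ ha (by positivity)]
            nlinarith
  calc (ρ ^ p)⁻¹ * (((ρ ^ m)⁻¹ * (ρ / (ρ + a)) ^ M) * ((ρ ^ m)⁻¹ * (ρ / (ρ + b)) ^ M))
      = (ρ ^ N)⁻¹ * ((ρ / (ρ + a)) ^ M * (ρ / (ρ + b)) ^ M) := by
        have : ρ ^ N = ρ ^ p * (ρ ^ m * ρ ^ m) := by
          rw [Real.rpow_add hρ, two_mul, Real.rpow_add hρ, Real.rpow_natCast]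
        rw [this, mul_inv, mul_inv]; ring
    _ ≤ (ρ ^ N)⁻¹ * (3 * ρ / (s + a)) ^ N := by gcongr
    _ = _ := by
        rw [Real.div_rpow (by positivity) (by positivity), Real.mul_rpow (by norm_num) hρ.le,
          Real.rpow_neg (by positivity)]
        have : ρ ^ N ≠ 0 := by positivity
        field_simp

section Integrals

variable {n : ℕ}

/-- Translation and scaling by `s` reduce to `∫ (1 + |x|)^(-N)`, finite because `N > n`. -/
theorem exists_lintegral_add_norm_rpow_le (n : ℕ) {N : ℝ} (hN : n < N) :
    ∃ C : ℝ≥0, ∀ (y : EuclideanSpace ℝ (Fin n)) (s : ℝ), 0 < s →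
      ∫⁻ x, ENNReal.ofReal ((s + dist x y) ^ (-N)) ≤ C * ENNReal.ofReal (s ^ (n - N)) := by
  have hfin := finite_integral_one_add_norm (E := EuclideanSpace ℝ (Fin n)) (μ := volume) (r := N)
    (by simpa using hN)
  refine ⟨(∫⁻ x : EuclideanSpace ℝ (Fin n), ENNReal.ofReal ((1 + ‖x‖) ^ (-N))).toNNReal,
    fun y s hs => ?_⟩
  rw [ENNReal.coe_toNNReal hfin.ne]
  simp_rw [dist_eq_norm]
  rw [lintegral_sub_right_eq_self (fun x => ENNReal.ofReal ((s + ‖x‖) ^ (-N))) y]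
  have h1 : ∀ x : EuclideanSpace ℝ (Fin n), ENNReal.ofReal ((s + ‖x‖) ^ (-N))
      = ENNReal.ofReal (s ^ (-N)) * ENNReal.ofReal ((1 + ‖s⁻¹ • x‖) ^ (-N)) := by
    intro x
    rw [← ENNReal.ofReal_mul (by positivity), ← Real.mul_rpow hs.le (by positivity), norm_smul,
      norm_inv, Real.norm_of_nonneg hs.le]
    congr 2
    field_simp
  simp_rw [h1]
  have hmeas : Measurable fun x : EuclideanSpace ℝ (Fin n) =>
      ENNReal.ofReal ((1 + ‖x‖) ^ (-N)) := by fun_prop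
  rw [lintegral_const_mul _ (by fun_prop),
    ← lintegral_map hmeas (measurable_const_smul s⁻¹),
    Measure.map_addHaar_smul _ (inv_ne_zero hs.ne'), lintegral_smul_measure, smul_eq_mul,
    ← mul_assoc, ← ENNReal.ofReal_mul (by positivity), mul_comm]
  gcongr
  rw [finrank_euclideanSpace_fin, inv_pow, inv_inv, abs_of_pos (by positivity), sub_eq_neg_add,
    Real.rpow_add hs, Real.rpow_natCast]

/-- In polar coordinates the Jacobian `r^(n-1)` cancels the singularity. -/
theorem exists_setLIntegral_inv_dist_pow_le (hn : 1 ≤ n) {s : Set (EuclideanSpace ℝ (Fin n))}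
    {R : ℝ} : ∃ C : ℝ≥0, ∀ y, s ⊆ Metric.ball y R →
      ∫⁻ x in s, ENNReal.ofReal ((dist x y ^ (n - 1))⁻¹) ≤ C := by
  have : Nonempty (Fin n) := ⟨⟨0, hn⟩⟩
  have hint : IntegrableOn (fun x : EuclideanSpace ℝ (Fin n) => (‖x‖ ^ (n - 1))⁻¹)
      (Metric.ball 0 R) volume := by
    rw [integrableOn_fun_norm_addHaar volume (f := fun r => (r ^ (n - 1))⁻¹),
      finrank_euclideanSpace_fin]
    refine (integrableOn_const (C := (1 : ℝ)) (by simp)).congr_fun (fun r hr => ?_)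
      measurableSet_Ioo
    have : r ≠ 0 := hr.1.ne'
    simp only [smul_eq_mul]
    field_simp
  refine ⟨(∫⁻ x in Metric.ball (0 : EuclideanSpace ℝ (Fin n)) R,
    ENNReal.ofReal ((‖x‖ ^ (n - 1))⁻¹)).toNNReal, fun y hy => ?_⟩
  have hfin : ∫⁻ x in Metric.ball (0 : EuclideanSpace ℝ (Fin n)) R,
      ENNReal.ofReal ((‖x‖ ^ (n - 1))⁻¹) < ∞ := hint.lintegral_lt_top
  rw [ENNReal.coe_toNNReal hfin.ne, ← lintegral_indicator measurableSet_ball,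
    ← lintegral_sub_right_eq_self (μ := volume) _ y]
  refine (lintegral_mono_set hy).trans (le_of_eq ?_)
  rw [← lintegral_indicator measurableSet_ball]
  refine lintegral_congr fun x => ?_
  simp [Set.indicator, dist_eq_norm]

end Integrals

/-! ### Pointwise bounds for boundary averages and their integrals over the domain -/

section Average

variable {n : ℕ} {S : Measure (EuclideanSpace ℝ (Fin n))}

theorem enorm_rpow_eq_ofReal (a : ℝ) {p : ℝ} (hp : 0 ≤ p) : ‖a‖ₑ ^ p = ENNReal.ofReal (|a| ^ p) := by
  rw [← ofReal_norm, ENNReal.ofReal_rpow_of_nonneg (norm_nonneg _) hp, Real.norm_eq_abs]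

/-- Meant for `x` on the boundary, where it measures how far the average at scale `ρ` is from the
boundary value. The diagonal `y = x` contributes zero on both sides. -/
theorem enorm_sub_kernelAvg_rpow_le_seminorm [IsFiniteMeasure S] [NeZero S] {M m : ℕ} {ρ B p : ℝ}
    (hρ : 0 < ρ) (hp : 1 ≤ p) (hM : p + 2 * m ≤ M) {x : EuclideanSpace ℝ (Fin n)}
    (hB : ∀ y, avgKernel S M ρ x y ≤ B * ((ρ ^ m)⁻¹ * (ρ / (ρ + dist x y)) ^ M)) (hB0 : 0 ≤ B)
    {f : EuclideanSpace ℝ (Fin n) → ℝ} (hf : Integrable f S) :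
    ‖f x - kernelAvg S M f ρ x‖ₑ ^ p ≤ ENNReal.ofReal (B * ρ ^ (p - 1)) *
      ∫⁻ y, ENNReal.ofReal (|f x - f y| ^ p / ‖x - y‖ ^ ((m : ℝ) + (p - 1))) ∂S := by
  refine (enorm_sub_kernelAvg_rpow_le hρ x hf (f x) hp).trans ?_
  rw [← lintegral_const_mul' _ _ ENNReal.ofReal_ne_top]
  refine lintegral_mono fun y => ?_
  rcases eq_or_ne x y with rfl | hxy
  · simp [ENNReal.zero_rpow_of_pos (by linarith : 0 < p)]
  rw [enorm_rpow_eq_ofReal _ (by linarith), ← ENNReal.ofReal_mul (avgKernel_pos M hρ x y).le,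
    ← ENNReal.ofReal_mul (by positivity)]
  refine ENNReal.ofReal_le_ofReal ?_
  have h := kernel_bound_le_trace hρ (dist_pos.2 hxy) hp hM
  rw [← dist_eq_norm]
  calc avgKernel S M ρ x y * |f x - f y| ^ p
      ≤ (B * (ρ ^ (p - 1) * (dist x y ^ ((m : ℝ) + (p - 1)))⁻¹)) * |f x - f y| ^ p := by
        gcongr
        exact (hB y).trans (by gcongr)
    _ = _ := by rw [div_eq_mul_inv]; ring

theorem enorm_kernelAvg_rpow_le [IsFiniteMeasure S] [NeZero S] {M m : ℕ} {ρ B p : ℝ}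
    (hρ : 0 < ρ) (hp : 1 ≤ p) (hM : m ≤ M) {x : EuclideanSpace ℝ (Fin n)}
    (hB : ∀ y, avgKernel S M ρ x y ≤ B * ((ρ ^ m)⁻¹ * (ρ / (ρ + dist x y)) ^ M)) (hB0 : 0 ≤ B)
    (hx : ∀ᵐ y ∂S, x ≠ y) {f : EuclideanSpace ℝ (Fin n) → ℝ} (hf : Integrable f S) :
    ‖kernelAvg S M f ρ x‖ₑ ^ p ≤ ENNReal.ofReal B *
      ∫⁻ y, ENNReal.ofReal ((dist x y ^ m)⁻¹) * ‖f y‖ₑ ^ p ∂S := by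
  have h := enorm_sub_kernelAvg_rpow_le (M := M) hρ x hf 0 hp
  simp only [zero_sub, enorm_neg] at h
  refine h.trans ?_
  rw [← lintegral_const_mul' _ _ ENNReal.ofReal_ne_top]
  refine lintegral_mono_ae ?_
  filter_upwards [hx] with y hxy
  rw [← mul_assoc, ← ENNReal.ofReal_mul hB0]
  gcongr
  exact (hB y).trans (by gcongr; exact kernel_bound_le_pow hρ (dist_pos.2 hxy) hM)

/-- Jensen in `y`, then in `z` after writing `f y` minus the average as an average of differences.
The factor `ρ^(-p)` is absorbed, so the right-hand side does not contain the scale. -/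
theorem lintegral_oscillation_rpow_le [IsFiniteMeasure S] [NeZero S] {M m : ℕ} {ρ B p : ℝ}
    (hρ : 0 < ρ) (hp : 1 ≤ p) (hM : p + 2 * m ≤ M) {x : EuclideanSpace ℝ (Fin n)}
    (hB : ∀ y, avgKernel S M ρ x y ≤ B * ((ρ ^ m)⁻¹ * (ρ / (ρ + dist x y)) ^ M)) (hB0 : 0 ≤ B)
    (hx : ∀ᵐ y ∂S, x ≠ y) {f : EuclideanSpace ℝ (Fin n) → ℝ} (hf : Integrable f S) :
    ENNReal.ofReal ((ρ ^ p)⁻¹) *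
      (∫⁻ y, ENNReal.ofReal (avgKernel S M ρ x y) * ‖f y - kernelAvg S M f ρ x‖ₑ ∂S) ^ p
      ≤ ENNReal.ofReal (B ^ 2 * 3 ^ (p + 2 * m)) * ∫⁻ y, ∫⁻ z,
        ENNReal.ofReal ((dist y z + dist x y) ^ (-(p + 2 * m))) * ‖f y - f z‖ₑ ^ p ∂S ∂S := by
  have h := rpow_lintegral_mul_le (μ := S)
    (k := fun y => ENNReal.ofReal (avgKernel S M ρ x y))
    (g := fun y => ‖f y - kernelAvg S M f ρ x‖ₑ)
    (measurable_avgKernel M ρ x).ennreal_ofReal.aemeasurable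
    (hf.aestronglyMeasurable.sub aestronglyMeasurable_const).enorm (lintegral_avgKernel M hρ x) hp
  refine (mul_le_mul_right h _).trans ?_
  rw [← lintegral_const_mul' _ _ ENNReal.ofReal_ne_top,
    ← lintegral_const_mul' _ _ ENNReal.ofReal_ne_top]
  refine lintegral_mono_ae ?_
  filter_upwards [hx] with y hxy
  refine (mul_le_mul_right (mul_le_mul_right
    (enorm_sub_kernelAvg_rpow_le (M := M) hρ x hf (f y) hp) _) _).trans ?_
  rw [← lintegral_const_mul' _ _ ENNReal.ofReal_ne_top,
    ← lintegral_const_mul' _ _ ENNReal.ofReal_ne_top,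
    ← lintegral_const_mul' _ _ ENNReal.ofReal_ne_top]
  refine lintegral_mono_ae ?_
  filter_upwards [hx] with z hxz
  have hk := (avgKernel_pos (S := S) M hρ x y).le
  rw [← mul_assoc, ← mul_assoc, ← mul_assoc, ← ENNReal.ofReal_mul (by positivity),
    ← ENNReal.ofReal_mul (by positivity), ← ENNReal.ofReal_mul (by positivity)]
  refine mul_le_mul_left (ENNReal.ofReal_le_ofReal ?_) _
  have hsab : dist y z ≤ dist x y + dist x z := by
    rw [dist_comm x y]; exact dist_triangle _ _ _
  have h2 := kernel_bound_mul_le hρ (dist_pos.2 hxy) (dist_pos.2 hxz) dist_nonneg hsab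
    (by linarith : 0 ≤ p) hM
  calc (ρ ^ p)⁻¹ * avgKernel S M ρ x y * avgKernel S M ρ x z
      ≤ (ρ ^ p)⁻¹ * (B * ((ρ ^ m)⁻¹ * (ρ / (ρ + dist x y)) ^ M)) *
        (B * ((ρ ^ m)⁻¹ * (ρ / (ρ + dist x z)) ^ M)) := by
        have hk' := (avgKernel_pos (S := S) M hρ x z).le
        gcongr
        · exact hB y
        · exact hB z
    _ = B ^ 2 * ((ρ ^ p)⁻¹ * (((ρ ^ m)⁻¹ * (ρ / (ρ + dist x y)) ^ M) *
        ((ρ ^ m)⁻¹ * (ρ / (ρ + dist x z)) ^ M))) := by ring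
    _ ≤ B ^ 2 * (3 ^ (p + 2 * m) * (dist y z + dist x y) ^ (-(p + 2 * m))) := by gcongr
    _ = _ := by ring

/-- By Tonelli, `x` is integrated first. The exponent becomes `n - (p + 2(n-1)) = -((n-1) + (p-1))`,
exactly that of the seminorm; convergence needs `p + 2(n-1) > n`, which follows from `p > 1`. -/
theorem exists_lintegral_oscillation_le (hn : 1 ≤ n) {p : ℝ} (hp : 1 < p) :
    ∃ C : ℝ≥0, ∀ (S : Measure (EuclideanSpace ℝ (Fin n))) [IsFiniteMeasure S]
      (f : EuclideanSpace ℝ (Fin n) → ℝ), Measurable f →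
      ∫⁻ x, ∫⁻ y, ∫⁻ z, ENNReal.ofReal ((dist y z + dist x y) ^ (-(p + 2 * (n - 1 : ℕ)))) *
          ‖f y - f z‖ₑ ^ p ∂S ∂S
        ≤ C * ∫⁻ y, ∫⁻ z,
          ENNReal.ofReal (|f y - f z| ^ p / ‖y - z‖ ^ (((n - 1 : ℕ) : ℝ) + (p - 1))) ∂S ∂S := by
  have hn' : (n : ℝ) = ((n - 1 : ℕ) : ℝ) + 1 := by exact_mod_cast (Nat.sub_add_cancel hn).symm
  have hm : (0 : ℝ) ≤ ((n - 1 : ℕ) : ℝ) := by positivity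
  obtain ⟨C, hC⟩ := exists_lintegral_add_norm_rpow_le n (N := p + 2 * (n - 1 : ℕ)) (by linarith)
  refine ⟨C, fun S _ f hf => ?_⟩
  rw [lintegral_lintegral_swap (by
    refine Measurable.aemeasurable ?_
    exact Measurable.lintegral_prod_right' (f := fun q : (EuclideanSpace ℝ (Fin n) ×
      EuclideanSpace ℝ (Fin n)) × EuclideanSpace ℝ (Fin n) =>
      ENNReal.ofReal ((dist q.1.2 q.2 + dist q.1.1 q.1.2) ^ (-(p + 2 * (n - 1 : ℕ)))) *
        ‖f q.1.2 - f q.2‖ₑ ^ p) (by fun_prop))]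
  rw [← lintegral_const_mul' _ _ ENNReal.coe_ne_top]
  refine lintegral_mono fun y => ?_
  rw [lintegral_lintegral_swap (by
    refine Measurable.aemeasurable ?_
    simp only [Function.uncurry_def]
    fun_prop), ← lintegral_const_mul' _ _ ENNReal.coe_ne_top]
  refine lintegral_mono fun z => ?_
  rw [lintegral_mul_const _ (by fun_prop)]
  rcases eq_or_ne y z with rfl | hyz
  · simp [ENNReal.zero_rpow_of_pos (by linarith : 0 < p)]
  · refine (mul_le_mul_left (hC y _ (dist_pos.2 hyz)) _).trans (le_of_eq ?_)
    rw [mul_assoc, enorm_rpow_eq_ofReal _ (by linarith), ← ENNReal.ofReal_mul (by positivity)]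
    congr 2
    rw [← dist_eq_norm y z, div_eq_mul_inv, mul_comm, ← Real.rpow_neg dist_nonneg]
    congr 2
    rw [hn']; ring

theorem exists_setLIntegral_weighted_le (hn : 1 ≤ n) {s : Set (EuclideanSpace ℝ (Fin n))}
    {R : ℝ} : ∃ C : ℝ≥0, ∀ (S : Measure (EuclideanSpace ℝ (Fin n))) [IsFiniteMeasure S]
      (f : EuclideanSpace ℝ (Fin n) → ℝ) (p : ℝ), Measurable f →
      (∀ᵐ y ∂S, s ⊆ Metric.ball y R) →
      ∫⁻ x in s, ∫⁻ y, ENNReal.ofReal ((dist x y ^ (n - 1))⁻¹) * ‖f y‖ₑ ^ p ∂S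
        ≤ C * ∫⁻ y, ‖f y‖ₑ ^ p ∂S := by
  obtain ⟨C, hC⟩ := exists_setLIntegral_inv_dist_pow_le hn (s := s) (R := R)
  refine ⟨C, fun S _ f p hf hs => ?_⟩
  rw [lintegral_lintegral_swap (by
    refine Measurable.aemeasurable ?_
    simp only [Function.uncurry_def]
    fun_prop), ← lintegral_const_mul' _ _ ENNReal.coe_ne_top]
  refine lintegral_mono_ae ?_
  filter_upwards [hs] with y hy
  rw [lintegral_mul_const _ (by fun_prop)]
  gcongr
  exact hC y hy

/-- On a bounded Lipschitz open set the normalized kernel of the surface measure is bounded, at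
scales at least the distance to the boundary. -/
theorem exists_avgKernel_surfaceMeasure_le (hn : 1 ≤ n) {U : Set (EuclideanSpace ℝ (Fin n))}
    (hU : IsBoundedLipschitzOpen U) (hne : (frontier U).Nonempty) (M : ℕ) (R : ℝ) :
    NeZero (surfaceMeasure U) ∧ ∃ B : ℝ, 0 < B ∧ ∀ x ρ, 0 < ρ →
      Metric.infDist x (frontier U) ≤ ρ → ρ ≤ R → ∀ y,
      avgKernel (surfaceMeasure U) M ρ x y
        ≤ B * ((ρ ^ (n - 1))⁻¹ * (ρ / (ρ + dist x y)) ^ M) := by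
  have := isFiniteMeasure_surfaceMeasure hn hU
  have hz : NeZero (surfaceMeasure U) := by
    obtain ⟨c, hc, h⟩ := exists_surfaceMeasure_ball_ge hn hU 1
    obtain ⟨y, hy⟩ := hne
    refine ⟨fun h0 => ?_⟩
    have := h y hy 1 one_pos le_rfl
    simp [h0, hc.not_ge] at this
  refine ⟨hz, ?_⟩
  obtain ⟨c, hc, h⟩ := exists_surfaceMeasure_ball_ge hn hU R
  refine ⟨3 ^ M / c, by positivity, fun x ρ hρ hd hR y => ?_⟩
  obtain ⟨y₀, hy₀, hxy⟩ := (isCompact_frontier_of_isBounded hU.isBounded).exists_infDist_eq_dist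
    hne x
  refine (avgKernel_le M (n - 1) hρ hc (hxy ▸ hd) (h y₀ hy₀ ρ hρ hR) y).trans (le_of_eq ?_)
  ring

end Average

/-! ### Sobolev functions that are locally Lipschitz -/

section Sobolev

variable {n : ℕ}

theorem norm_gradient_eq (g : EuclideanSpace ℝ (Fin n) → ℝ) (x : EuclideanSpace ℝ (Fin n)) :
    ‖gradient g x‖ = ‖fderiv ℝ g x‖ := by
  rw [gradient, LinearIsometryEquiv.norm_map]

theorem gradient_congr_of_eventuallyEq {g h : EuclideanSpace ℝ (Fin n) → ℝ}
    {x : EuclideanSpace ℝ (Fin n)} (hgh : g =ᶠ[𝓝 x] h) : gradient g x = gradient h x := by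
  rw [gradient, gradient, hgh.fderiv_eq]

theorem measurable_gradient (g : EuclideanSpace ℝ (Fin n) → ℝ) : Measurable (gradient g) :=
  (InnerProductSpace.toDual ℝ (EuclideanSpace ℝ (Fin n))).symm.continuous.measurable.comp
    (measurable_fderiv ℝ g)

/-- Integration by parts for a function that agrees with a Lipschitz function near the support of
the test function. -/
theorem setIntegral_mul_fderiv_eq {U V : Set (EuclideanSpace ℝ (Fin n))} (hV : IsOpen V)
    (hVU : V ⊆ U) {g h : EuclideanSpace ℝ (Fin n) → ℝ} {L : ℝ≥0} (hh : LipschitzWith L h)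
    (hgh : Set.EqOn g h V) {φ : EuclideanSpace ℝ (Fin n) → ℝ} (hφ : ContDiff ℝ (⊤ : ℕ∞) φ)
    (hφc : HasCompactSupport φ) (hφV : tsupport φ ⊆ V) (v : EuclideanSpace ℝ (Fin n)) :
    ∫ x in U, g x * fderiv ℝ φ x v = - ∫ x in U, inner ℝ (gradient g x) v * φ x := by
  have h0 : ∀ x, x ∉ V → φ x = 0 := fun x hx => image_eq_zero_of_notMem_tsupport fun h => hx (hφV h)
  have h0' : ∀ x, x ∉ V → fderiv ℝ φ x = 0 := fun x hx => by
    have := support_fderiv_subset ℝ (f := φ)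
    by_contra hne
    exact hx (hφV (this hne))
  obtain ⟨D, hD⟩ := (hφ.of_le (by norm_cast) : ContDiff ℝ 1 φ).lipschitzWith_of_hasCompactSupport
    hφc one_ne_zero
  rw [setIntegral_eq_integral_of_forall_compl_eq_zero
      (fun x hx => by rw [h0' x fun h => hx (hVU h)]; simp),
    setIntegral_eq_integral_of_forall_compl_eq_zero
      (fun x hx => by rw [h0 x fun h => hx (hVU h)]; simp)]
  have e1 : ∫ x, g x * fderiv ℝ φ x v = - ∫ x, lineDeriv ℝ φ x (-v) * h x := by
    rw [← integral_neg]
    congr 1; ext x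
    rw [((hφ.differentiable (by simp)) x).lineDeriv_eq_fderiv, map_neg]
    by_cases hx : x ∈ V
    · rw [hgh hx]; ring
    · rw [h0' x hx]; simp
  have e2 : ∫ x, inner ℝ (gradient g x) v * φ x = ∫ x, lineDeriv ℝ h x v * φ x := by
    refine integral_congr_ae ?_
    -- Rademacher's theorem: almost everywhere the line derivative is given by the gradient.
    filter_upwards [hh.ae_differentiableAt] with x hx
    by_cases hxV : x ∈ V
    · have : g =ᶠ[𝓝 x] h := by
        filter_upwards [hV.mem_nhds hxV] with z hz using hgh hz
      rw [gradient_congr_of_eventuallyEq this, inner_gradient_left, hx.lineDeriv_eq_fderiv]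
    · rw [h0 x hxV]; simp
  rw [e1, e2, hh.integral_lineDeriv_mul_eq hD hφc v]

theorem memSobolev_of_lipschitzOnWith {U : Set (EuclideanSpace ℝ (Fin n))} (hU : IsOpen U)
    (hUb : Bornology.IsBounded U) {g : EuclideanSpace ℝ (Fin n) → ℝ} {L : ℝ≥0}
    (hg : LipschitzOnWith L g U) (p : ℝ) : MemSobolev U p g (gradient g) := by
  have hfin : IsFiniteMeasure (volume.restrict U) := ⟨by
    rw [Measure.restrict_apply_univ]; exact hUb.measure_lt_top⟩
  have hgrad : ∀ x ∈ U, ‖gradient g x‖ ≤ L := fun x hx => by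
    rw [norm_gradient_eq]
    refine norm_fderiv_le_of_lip' ℝ L.2 ?_
    filter_upwards [hU.mem_nhds hx] with z hz using hg.norm_sub_le hz hx
  obtain ⟨h, hh, hgh⟩ := hg.extend_real
  obtain ⟨b, hb⟩ := (hh.isBounded_image hUb).exists_norm_le
  refine ⟨?_, ?_, fun φ hφ hφc hφU v =>
    setIntegral_mul_fderiv_eq hU subset_rfl hh hgh hφ hφc hφU v⟩
  · exact MemLp.of_bound (hg.continuousOn.aestronglyMeasurable hU.measurableSet) b
      (ae_restrict_of_forall_mem hU.measurableSet fun x hx => hb _ ⟨x, hx, (hgh hx).symm⟩)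
  · exact MemLp.of_bound (measurable_gradient g).aestronglyMeasurable L
      (ae_restrict_of_forall_mem hU.measurableSet hgrad)

/-- Dominated convergence. Pointwise convergence takes the form of eventual equality, because a
regularization at scale `ε` already agrees with the limit at every point farther than `ε` from the
boundary. -/
theorem tendsto_eLpNorm_sub_of_dominated {α F : Type*} [MeasurableSpace α] [NormedAddCommGroup F]
    {μ : Measure α} {p : ℝ} (hp : 1 ≤ p) {g : ℕ → α → F} {g₀ : α → F} {G : α → ℝ≥0∞}
    (hg : ∀ k, AEStronglyMeasurable (g k) μ) (hg₀ : AEStronglyMeasurable g₀ μ)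
    (hgG : ∀ k, ∀ᵐ x ∂μ, ‖g k x‖ₑ ^ p ≤ G x) (hg₀G : ∀ᵐ x ∂μ, ‖g₀ x‖ₑ ^ p ≤ G x)
    (hG : ∫⁻ x, G x ∂μ ≠ ∞) (hlim : ∀ᵐ x ∂μ, ∀ᶠ k in atTop, g k x = g₀ x) :
    Tendsto (fun k => eLpNorm (g k - g₀) (ENNReal.ofReal p) μ) atTop (𝓝 0) := by
  have hp0 : 0 < p := by linarith
  have key : Tendsto (fun k => ∫⁻ x, ‖(g k - g₀) x‖ₑ ^ p ∂μ) atTop (𝓝 (∫⁻ _, 0 ∂μ)) := by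
    refine tendsto_lintegral_of_dominated_convergence' (fun x => 2 ^ (p - 1) * (G x + G x))
      (fun k => ((hg k).sub hg₀).enorm.pow_const p) (fun k => ?_) ?_ ?_
    · filter_upwards [hgG k, hg₀G] with x h1 h2
      calc ‖(g k - g₀) x‖ₑ ^ p ≤ (‖g k x‖ₑ + ‖g₀ x‖ₑ) ^ p := by
            gcongr; exact enorm_sub_le
        _ ≤ 2 ^ (p - 1) * (‖g k x‖ₑ ^ p + ‖g₀ x‖ₑ ^ p) :=
            ENNReal.rpow_add_le_mul_rpow_add_rpow _ _ hp
        _ ≤ _ := by gcongr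
    · rw [lintegral_const_mul' _ _ (by finiteness)]
      refine ENNReal.mul_ne_top (by finiteness) ?_
      have h2 : ∀ x, G x + G x = 2 * G x := fun x => (two_mul _).symm
      simp_rw [h2]
      rw [lintegral_const_mul' _ _ (by finiteness)]
      exact ENNReal.mul_ne_top (by finiteness) hG
    · filter_upwards [hlim] with x hx
      refine tendsto_const_nhds.congr' ?_
      filter_upwards [hx] with k hk
      simp [hk, hp0]
  have h3 : ∀ k, eLpNorm (g k - g₀) (ENNReal.ofReal p) μ
      = (∫⁻ x, ‖(g k - g₀) x‖ₑ ^ p ∂μ) ^ (1 / p) := fun k => by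
    rw [eLpNorm_eq_lintegral_rpow_enorm_toReal (by simpa using hp0) ENNReal.ofReal_ne_top,
      ENNReal.toReal_ofReal hp0.le]
  simp_rw [h3]
  have h4 := key.ennrpow_const (1 / p)
  simpa [hp0] using h4

end Sobolev

/-! ### The extension of boundary values -/

section Extension

variable {n : ℕ}

/-- Extension of `f` from the boundary of `U`: the average of `f` at the scale of the distance to
the boundary, but at least `ε`, cut off at distance `δ`. -/
def boundaryExt (U : Set (EuclideanSpace ℝ (Fin n))) (M : ℕ) (δ : ℝ)
    (f : EuclideanSpace ℝ (Fin n) → ℝ) (ε : ℝ) (x : EuclideanSpace ℝ (Fin n)) : ℝ :=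
  max 0 (1 - Metric.infDist x (frontier U) / δ) *
    kernelAvg (surfaceMeasure U) M f (max (Metric.infDist x (frontier U)) ε) x

/-- A majorant for the `p`-th powers of the extension and of its gradient. -/
def extMajorant (S : Measure (EuclideanSpace ℝ (Fin n))) (m : ℕ) (p : ℝ)
    (f : EuclideanSpace ℝ (Fin n) → ℝ) (x : EuclideanSpace ℝ (Fin n)) : ℝ≥0∞ :=
  (∫⁻ y, ∫⁻ z, ENNReal.ofReal ((dist y z + dist x y) ^ (-(p + 2 * m))) * ‖f y - f z‖ₑ ^ p ∂S ∂S) +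
    ∫⁻ y, ENNReal.ofReal ((dist x y ^ m)⁻¹) * ‖f y‖ₑ ^ p ∂S

variable {U : Set (EuclideanSpace ℝ (Fin n))}

theorem cutoff_le_one {δ : ℝ} (hδ : 0 < δ) (x : EuclideanSpace ℝ (Fin n)) :
    |max 0 (1 - Metric.infDist x (frontier U) / δ)| ≤ 1 := by
  have : 0 ≤ Metric.infDist x (frontier U) / δ := div_nonneg Metric.infDist_nonneg hδ.le
  rw [abs_of_nonneg (le_max_left _ _)]
  exact max_le zero_le_one (by linarith)

/-- A product rule for differences. The scale is 1-Lipschitz in the point, so scale and centre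
together move by at most `2 * dist x' x`; this is why `ρ / 4` suffices for the kernel comparison. -/
theorem abs_boundaryExt_sub_le [IsFiniteMeasure (surfaceMeasure U)] [NeZero (surfaceMeasure U)]
    {M : ℕ} {δ ε : ℝ} (hδ : 0 < δ) {x x' : EuclideanSpace ℝ (Fin n)} {ρ : ℝ}
    (hρ : 0 < ρ) (hρx : max (Metric.infDist x (frontier U)) ε = ρ) (hx' : dist x' x ≤ ρ / 4)
    {f : EuclideanSpace ℝ (Fin n) → ℝ} (hf : Integrable f (surfaceMeasure U)) :
    |boundaryExt U M δ f ε x' - boundaryExt U M δ f ε x| ≤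
      (M * 2 ^ (2 * M + 1) * (2 * ρ⁻¹) * (∫ y, avgKernel (surfaceMeasure U) M ρ x y *
        |f y - kernelAvg (surfaceMeasure U) M f ρ x| ∂(surfaceMeasure U)) +
        δ⁻¹ * |kernelAvg (surfaceMeasure U) M f ρ x|) * dist x' x := by
  set d := fun z => Metric.infDist z (frontier U) with hd
  set A := kernelAvg (surfaceMeasure U) M f ρ x with hA
  have hdd : |d x' - d x| ≤ dist x' x := by
    have := (Metric.lipschitz_infDist_pt (frontier U)).dist_le_mul x' x
    simpa [Real.dist_eq] using this
  have hρρ : |max (d x') ε - ρ| ≤ dist x' x := by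
    rw [← hρx]
    exact (abs_max_sub_max_le_abs _ _ _).trans hdd
  set A' := kernelAvg (surfaceMeasure U) M f (max (d x') ε) x' with hA'
  have h1 : |A' - A| ≤ M * 2 ^ (2 * M + 1) * (2 * ρ⁻¹ * dist x' x) *
      ∫ y, avgKernel (surfaceMeasure U) M ρ x y * |f y - A| ∂(surfaceMeasure U) := by
    have hI : 0 ≤ ∫ y, avgKernel (surfaceMeasure U) M ρ x y * |f y - A| ∂(surfaceMeasure U) :=
      integral_nonneg fun y => mul_nonneg (avgKernel_pos M hρ x y).le (abs_nonneg _)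
    refine (abs_kernelAvg_sub_le hρ (by linarith) hf).trans ?_
    gcongr
    rw [div_eq_inv_mul, mul_assoc 2, mul_left_comm]
    gcongr
    linarith
  have h2 : |max 0 (1 - d x' / δ) - max 0 (1 - d x / δ)| ≤ δ⁻¹ * dist x' x := by
    rw [max_comm 0, max_comm 0]
    refine (abs_max_sub_max_le_abs _ _ _).trans ?_
    have : 1 - d x' / δ - (1 - d x / δ) = -(δ⁻¹ * (d x' - d x)) := by field_simp; ring
    rw [this, abs_neg, abs_mul, abs_of_pos (inv_pos.2 hδ)]
    gcongr
  have e : boundaryExt U M δ f ε x' - boundaryExt U M δ f ε x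
      = max 0 (1 - d x' / δ) * (A' - A)
        + (max 0 (1 - d x' / δ) - max 0 (1 - d x / δ)) * A := by
    simp only [boundaryExt]
    rw [hρx, ← hA, ← hA']; ring
  rw [e]
  refine (abs_add_le _ _).trans ?_
  rw [abs_mul, abs_mul, add_mul]
  refine add_le_add ?_ ?_
  · calc _ ≤ 1 * |A' - A| := by gcongr; exact cutoff_le_one hδ x'
      _ ≤ _ := by rw [one_mul]; refine h1.trans (le_of_eq ?_); ring
  · calc _ ≤ δ⁻¹ * dist x' x * |A| := by gcongr
      _ = _ := by ring

/-- The local difference bound passes to the gradient without proving differentiability, since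
`fderiv` is zero where the derivative does not exist. -/
theorem norm_gradient_boundaryExt_le [IsFiniteMeasure (surfaceMeasure U)]
    [NeZero (surfaceMeasure U)] {M : ℕ} {δ ε : ℝ} (hδ : 0 < δ) {x : EuclideanSpace ℝ (Fin n)}
    {ρ : ℝ} (hρ : 0 < ρ) (hρx : max (Metric.infDist x (frontier U)) ε = ρ)
    {f : EuclideanSpace ℝ (Fin n) → ℝ} (hf : Integrable f (surfaceMeasure U)) :
    ‖gradient (boundaryExt U M δ f ε) x‖ ≤
      M * 2 ^ (2 * M + 1) * (2 * ρ⁻¹) * (∫ y, avgKernel (surfaceMeasure U) M ρ x y *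
        |f y - kernelAvg (surfaceMeasure U) M f ρ x| ∂(surfaceMeasure U)) +
        δ⁻¹ * |kernelAvg (surfaceMeasure U) M f ρ x| := by
  have hI : 0 ≤ ∫ y, avgKernel (surfaceMeasure U) M ρ x y *
      |f y - kernelAvg (surfaceMeasure U) M f ρ x| ∂(surfaceMeasure U) :=
    integral_nonneg fun y => mul_nonneg (avgKernel_pos M hρ x y).le (abs_nonneg _)
  rw [norm_gradient_eq]
  refine norm_fderiv_le_of_lip' ℝ (by positivity) ?_
  filter_upwards [Metric.closedBall_mem_nhds x (by positivity : 0 < ρ / 4)] with z hz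
  rw [← dist_eq_norm z x, Real.norm_eq_abs]
  exact abs_boundaryExt_sub_le hδ hρ hρx hz hf

/-- The constant and the majorant depend on neither `ε` nor `ρ`. The same majorant therefore bounds
the extension and dominates its regularizations. -/
theorem exists_boundaryExt_le_extMajorant (M m : ℕ) {p B δ : ℝ} (hp : 1 ≤ p)
    (hM : p + 2 * m ≤ M) (hB0 : 0 ≤ B) (hδ : 0 < δ) :
    ∃ C : ℝ≥0, ∀ (U : Set (EuclideanSpace ℝ (Fin n))) [IsFiniteMeasure (surfaceMeasure U)]
      [NeZero (surfaceMeasure U)] (f : EuclideanSpace ℝ (Fin n) → ℝ)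
      (x : EuclideanSpace ℝ (Fin n)) (ε ρ : ℝ), Integrable f (surfaceMeasure U) →
      max (Metric.infDist x (frontier U)) ε = ρ → 0 < ρ →
      (∀ y, avgKernel (surfaceMeasure U) M ρ x y
        ≤ B * ((ρ ^ m)⁻¹ * (ρ / (ρ + dist x y)) ^ M)) →
      (∀ᵐ y ∂(surfaceMeasure U), x ≠ y) →
      ‖gradient (boundaryExt U M δ f ε) x‖ₑ ^ p ≤ C * extMajorant (surfaceMeasure U) m p f x ∧
      ‖boundaryExt U M δ f ε x‖ₑ ^ p ≤ C * extMajorant (surfaceMeasure U) m p f x := by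
  have hp0 : 0 ≤ p := by linarith
  set a : ℝ := M * 2 ^ (2 * M + 1) * 2 with ha
  have ha0 : 0 ≤ a := by positivity
  have hmM : m ≤ M := by
    have h : (m : ℝ) ≤ M := by
      have : (0 : ℝ) ≤ m := by positivity
      linarith
    exact_mod_cast h
  set C₁ : ℝ≥0∞ := ENNReal.ofReal a ^ p * ENNReal.ofReal (B ^ 2 * 3 ^ (p + 2 * m)) with hC₁
  set C₂ : ℝ≥0∞ := ENNReal.ofReal δ⁻¹ ^ p * ENNReal.ofReal B with hC₂
  have hC₁t : C₁ ≠ ∞ := by finiteness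
  have hC₂t : C₂ ≠ ∞ := by finiteness
  set C : ℝ≥0∞ := 2 ^ (p - 1) * (C₁ + C₂) + ENNReal.ofReal B with hC
  have hCt : C ≠ ∞ := by finiteness
  refine ⟨C.toNNReal, fun U _ _ f x ε ρ hf hρx hρ hB hx => ?_⟩
  rw [ENNReal.coe_toNNReal hCt]
  set S := surfaceMeasure U
  set A := kernelAvg S M f ρ x with hA
  set I := ∫⁻ y, ENNReal.ofReal (avgKernel S M ρ x y) * ‖f y - A‖ₑ ∂S with hI
  have hosc := lintegral_oscillation_rpow_le hρ hp hM hB hB0 hx hf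
  have havg := enorm_kernelAvg_rpow_le hρ hp hmM hB hB0 hx hf
  rw [← hA] at hosc havg
  rw [← hI] at hosc
  unfold extMajorant
  set W₁ := ∫⁻ y, ∫⁻ z, ENNReal.ofReal ((dist y z + dist x y) ^ (-(p + 2 * m))) *
    ‖f y - f z‖ₑ ^ p ∂S ∂S
  set W₀ := ∫⁻ y, ENNReal.ofReal ((dist x y ^ m)⁻¹) * ‖f y‖ₑ ^ p ∂S
  constructor
  · have hIr : ENNReal.ofReal (∫ y, avgKernel S M ρ x y * |f y - A| ∂S) ≤ I := by
      refine (Real.enorm_eq_ofReal (integral_nonneg fun y =>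
        mul_nonneg (avgKernel_pos M hρ x y).le (abs_nonneg _))).symm.le.trans ?_
      refine (enorm_integral_le_lintegral_enorm _).trans (le_of_eq (lintegral_congr fun y => ?_))
      rw [enorm_mul, Real.enorm_of_nonneg (avgKernel_pos M hρ x y).le, Real.enorm_abs]
    have h1 : ‖gradient (boundaryExt U M δ f ε) x‖ₑ
        ≤ ENNReal.ofReal a * (ENNReal.ofReal ρ⁻¹ * I) + ENNReal.ofReal δ⁻¹ * ‖A‖ₑ := by
      rw [← ofReal_norm]
      refine (ENNReal.ofReal_le_ofReal (norm_gradient_boundaryExt_le hδ hρ hρx hf)).trans ?_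
      have hint : 0 ≤ ∫ y, avgKernel S M ρ x y * |f y - A| ∂S :=
        integral_nonneg fun y => mul_nonneg (avgKernel_pos M hρ x y).le (abs_nonneg _)
      rw [ENNReal.ofReal_add (by positivity) (by positivity), ENNReal.ofReal_mul (p := δ⁻¹)
        (by positivity), ← Real.norm_eq_abs A, ofReal_norm,
        show (M : ℝ) * 2 ^ (2 * M + 1) * (2 * ρ⁻¹) = a * ρ⁻¹ by rw [ha]; ring, mul_assoc,
        ENNReal.ofReal_mul ha0]
      gcongr
      rw [ENNReal.ofReal_mul (by positivity)]
      exact mul_le_mul_right hIr _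
    calc ‖gradient (boundaryExt U M δ f ε) x‖ₑ ^ p
        ≤ (ENNReal.ofReal a * (ENNReal.ofReal ρ⁻¹ * I) + ENNReal.ofReal δ⁻¹ * ‖A‖ₑ) ^ p := by
          gcongr
      _ ≤ 2 ^ (p - 1) * ((ENNReal.ofReal a * (ENNReal.ofReal ρ⁻¹ * I)) ^ p +
          (ENNReal.ofReal δ⁻¹ * ‖A‖ₑ) ^ p) := ENNReal.rpow_add_le_mul_rpow_add_rpow _ _ hp
      _ = 2 ^ (p - 1) * (ENNReal.ofReal a ^ p * (ENNReal.ofReal (ρ ^ p)⁻¹ * I ^ p) +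
          ENNReal.ofReal δ⁻¹ ^ p * ‖A‖ₑ ^ p) := by
          rw [ENNReal.mul_rpow_of_nonneg _ _ hp0, ENNReal.mul_rpow_of_nonneg _ _ hp0,
            ENNReal.mul_rpow_of_nonneg _ _ hp0,
            ENNReal.ofReal_rpow_of_nonneg (by positivity : 0 ≤ ρ⁻¹) hp0, Real.inv_rpow hρ.le]
      _ ≤ 2 ^ (p - 1) * (ENNReal.ofReal a ^ p *
          (ENNReal.ofReal (B ^ 2 * 3 ^ (p + 2 * m)) * W₁) +
          ENNReal.ofReal δ⁻¹ ^ p * (ENNReal.ofReal B * W₀)) := by gcongr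
      _ = 2 ^ (p - 1) * (C₁ * W₁ + C₂ * W₀) := by rw [hC₁, hC₂]; ring
      _ ≤ 2 ^ (p - 1) * ((C₁ + C₂) * W₁ + (C₁ + C₂) * W₀) := by
          gcongr
          · exact le_self_add
          · exact le_add_self
      _ = (2 ^ (p - 1) * (C₁ + C₂)) * (W₁ + W₀) := by ring
      _ ≤ C * (W₁ + W₀) := by gcongr; exact le_self_add
  · calc ‖boundaryExt U M δ f ε x‖ₑ ^ p ≤ ‖A‖ₑ ^ p := by
          gcongr
          rw [boundaryExt, enorm_mul, hρx]
          calc _ ≤ 1 * ‖A‖ₑ := by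
                gcongr
                rw [← ofReal_norm, Real.norm_eq_abs]
                exact ENNReal.ofReal_le_one.2 (cutoff_le_one hδ x)
            _ = ‖A‖ₑ := one_mul _
      _ ≤ ENNReal.ofReal B * W₀ := havg
      _ ≤ C * (W₁ + W₀) := by
          gcongr
          · exact le_add_self
          · exact le_add_self

/-- Pairs farther apart than `r` are handled by the sup bound, so no convexity of `s` is needed. -/
theorem lipschitzOnWith_of_local {X : Type*} [PseudoMetricSpace X] {s : Set X} {g : X → ℝ}
    {r L W : ℝ} (hr : 0 < r)
    (hL : ∀ x ∈ s, ∀ x' ∈ s, dist x' x ≤ r → |g x' - g x| ≤ L * dist x' x)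
    (hW : ∀ x ∈ s, |g x| ≤ W) : LipschitzOnWith (max L (2 * W / r)).toNNReal g s := by
  refine LipschitzOnWith.of_dist_le_mul fun x' hx' x hx => ?_
  rw [Real.dist_eq]
  refine le_trans ?_ (mul_le_mul_of_nonneg_right (Real.le_coe_toNNReal _) dist_nonneg)
  rcases le_total (dist x' x) r with h | h
  · refine (hL x hx x' hx' h).trans ?_
    gcongr; exact le_max_left _ _
  · have hW0 : 0 ≤ W := (abs_nonneg _).trans (hW x hx)
    calc |g x' - g x| ≤ |g x'| + |g x| := abs_sub _ _
      _ ≤ W + W := add_le_add (hW x' hx') (hW x hx)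
      _ = 2 * W / r * r := by field_simp; ring
      _ ≤ max L (2 * W / r) * dist x' x := by
          gcongr; exact le_max_right _ _

/-- At scales at least `ε` the kernel is bounded by `B * ε⁻ᵐ`, so the averages are bounded by the
`L¹` norm of `f`. The Lipschitz constant may blow up as `ε → 0`; only its existence matters. -/
theorem exists_lipschitzOnWith_boundaryExt [IsFiniteMeasure (surfaceMeasure U)]
    [NeZero (surfaceMeasure U)] {M m : ℕ} {δ ε B R : ℝ} (hδ : 0 < δ) (hε : 0 < ε) (hεR : ε ≤ R)
    (hB0 : 0 ≤ B) (hB : ∀ x ρ, 0 < ρ → Metric.infDist x (frontier U) ≤ ρ → ρ ≤ R → ∀ y,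
      avgKernel (surfaceMeasure U) M ρ x y ≤ B * ((ρ ^ m)⁻¹ * (ρ / (ρ + dist x y)) ^ M))
    {s : Set (EuclideanSpace ℝ (Fin n))} (hs : ∀ x ∈ s, Metric.infDist x (frontier U) ≤ R)
    {f : EuclideanSpace ℝ (Fin n) → ℝ} (hf : Integrable f (surfaceMeasure U)) :
    ∃ L, LipschitzOnWith L (boundaryExt U M δ f ε) s := by
  set S := surfaceMeasure U
  set b := B * (ε ^ m)⁻¹ with hb
  have hb0 : 0 ≤ b := by positivity
  have hk : ∀ x ∈ s, ∀ y, avgKernel S M (max (Metric.infDist x (frontier U)) ε) x y ≤ b := by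
    intro x hx y
    set ρ := max (Metric.infDist x (frontier U)) ε
    have hρε : ε ≤ ρ := le_max_right _ _
    have hρ : 0 < ρ := hε.trans_le hρε
    have hd : 0 ≤ dist x y := dist_nonneg
    refine (hB x ρ hρ (le_max_left _ _) (max_le (hs x hx) hεR) y).trans ?_
    rw [hb]
    have h1 : (ρ / (ρ + dist x y)) ^ M ≤ 1 :=
      pow_le_one₀ (by positivity) ((div_le_one (by positivity)).2 (by linarith))
    calc B * ((ρ ^ m)⁻¹ * (ρ / (ρ + dist x y)) ^ M) ≤ B * ((ε ^ m)⁻¹ * 1) := by gcongr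
      _ = _ := by rw [mul_one]
  set W := b * ∫ y, |f y| ∂S with hW
  have hkint : ∀ x ∈ s, ∫ y, avgKernel S M (max (Metric.infDist x (frontier U)) ε) x y * |f y| ∂S
      ≤ W := by
    intro x hx
    have hρ : 0 < max (Metric.infDist x (frontier U)) ε := lt_max_of_lt_right hε
    rw [hW, ← integral_const_mul]
    refine integral_mono (integrable_avgKernel_mul hρ x hf.abs) (hf.abs.const_mul b) fun y => ?_
    exact mul_le_mul_of_nonneg_right (hk x hx y) (abs_nonneg _)
  have hA : ∀ x ∈ s, |kernelAvg S M f (max (Metric.infDist x (frontier U)) ε) x| ≤ W := by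
    intro x hx
    have hρ : 0 < max (Metric.infDist x (frontier U)) ε := lt_max_of_lt_right hε
    refine le_trans ?_ (hkint x hx)
    refine (abs_integral_le_integral_abs).trans (le_of_eq ?_)
    congr 1; ext y
    rw [abs_mul, abs_of_pos (avgKernel_pos M hρ x y)]
  refine ⟨_, lipschitzOnWith_of_local (r := ε / 4) (W := W)
    (L := M * 2 ^ (2 * M + 1) * (2 * ε⁻¹) * (W + W) + δ⁻¹ * W) (by positivity) ?_ ?_⟩
  · intro x hx x' _ hxx'
    set ρ := max (Metric.infDist x (frontier U)) ε with hρdef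
    have hρε : ε ≤ ρ := le_max_right _ _
    have hρ : 0 < ρ := hε.trans_le hρε
    refine (abs_boundaryExt_sub_le hδ hρ hρdef.symm (by linarith) hf).trans ?_
    have hI : ∫ y, avgKernel S M ρ x y * |f y - kernelAvg S M f ρ x| ∂S ≤ W + W := by
      calc ∫ y, avgKernel S M ρ x y * |f y - kernelAvg S M f ρ x| ∂S
          ≤ ∫ y, (avgKernel S M ρ x y * |f y| + avgKernel S M ρ x y * |kernelAvg S M f ρ x|) ∂S := by
            refine integral_mono
              (integrable_avgKernel_mul hρ x (hf.sub (integrable_const _)).abs)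
              ((integrable_avgKernel_mul hρ x hf.abs).add
                (integrable_avgKernel_mul hρ x (integrable_const _))) fun y => ?_
            simp only
            rw [← mul_add]
            exact mul_le_mul_of_nonneg_left (abs_sub _ _) (avgKernel_pos M hρ x y).le
        _ ≤ W + W := by
            rw [integral_add (integrable_avgKernel_mul hρ x hf.abs)
              (integrable_avgKernel_mul hρ x (integrable_const _)), integral_mul_const,
              integral_avgKernel M hρ x, one_mul]
            exact add_le_add (hkint x hx) (hA x hx)
    have hI0 : 0 ≤ ∫ y, avgKernel S M ρ x y * |f y - kernelAvg S M f ρ x| ∂S :=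
      integral_nonneg fun y => mul_nonneg (avgKernel_pos M hρ x y).le (abs_nonneg _)
    gcongr
    exact hA x hx
  · intro x hx
    rw [boundaryExt, abs_mul]
    calc _ ≤ 1 * W := by
          gcongr
          · exact cutoff_le_one hδ x
          · exact hA x hx
      _ = W := one_mul _

end Extension

/-! ### The extension operator: Sobolev regularity, trace and gradient bound -/

section ExtensionTheorem

variable {n : ℕ}

theorem frontier_nonempty_of_isBounded (hn : 1 ≤ n) {U : Set (EuclideanSpace ℝ (Fin n))}
    (hU : U.Nonempty) (hUb : Bornology.IsBounded U) : (frontier U).Nonempty := by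
  have : Nonempty (Fin n) := ⟨⟨0, hn⟩⟩
  refine nonempty_frontier_iff.2 ⟨hU, fun h => ?_⟩
  rw [h] at hUb
  exact NormedSpace.unbounded_univ ℝ (EuclideanSpace ℝ (Fin n)) hUb

theorem eLpNorm_ofReal_eq {α F : Type*} [MeasurableSpace α] [NormedAddCommGroup F]
    {μ : Measure α} {p : ℝ} (hp : 0 < p) (g : α → F) :
    eLpNorm g (ENNReal.ofReal p) μ = (∫⁻ x, ‖g x‖ₑ ^ p ∂μ) ^ (1 / p) := by
  rw [eLpNorm_eq_lintegral_rpow_enorm_toReal (by simpa using hp) ENNReal.ofReal_ne_top,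
    ENNReal.toReal_ofReal hp.le]

theorem eLpNorm_ofReal_rpow {α F : Type*} [MeasurableSpace α] [NormedAddCommGroup F]
    {μ : Measure α} {p : ℝ} (hp : 0 < p) (g : α → F) :
    eLpNorm g (ENNReal.ofReal p) μ ^ p = ∫⁻ x, ‖g x‖ₑ ^ p ∂μ := by
  rw [eLpNorm_ofReal_eq hp, ← ENNReal.rpow_mul, one_div_mul_cancel hp.ne', ENNReal.rpow_one]

theorem traceNorm_rpow_ge {Ω : Set (EuclideanSpace ℝ (Fin n))} {p : ℝ} (hp : 0 < p)
    (f : EuclideanSpace ℝ (Fin n) → ℝ) :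
    (∫⁻ x, ∫⁻ y, ENNReal.ofReal (|f x - f y| ^ p / ‖x - y‖ ^ ((n : ℝ) - 1 + (1 - 1 / p) * p))
      ∂(surfaceMeasure Ω) ∂(surfaceMeasure Ω)) ≤ traceNorm Ω p f ^ p ∧
    ∫⁻ x, ‖f x‖ₑ ^ p ∂(surfaceMeasure Ω) ≤ traceNorm Ω p f ^ p := by
  constructor
  · calc _ = slobodeckijSeminorm Ω p f ^ p := by
          rw [slobodeckijSeminorm, ← ENNReal.rpow_mul, one_div_mul_cancel hp.ne', ENNReal.rpow_one]
      _ ≤ _ := by gcongr; exact le_add_self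
  · rw [← eLpNorm_ofReal_rpow hp]
    gcongr; exact le_self_add

theorem exists_extension_of_measurable (hn : 2 ≤ n) {Ω : Set (EuclideanSpace ℝ (Fin n))}
    (hΩ : IsLipschitzDomain Ω) {p : ℝ} (hp : 1 < p) {δ : ℝ} (hδ : 0 < δ) :
    ∃ C : ℝ≥0, ∀ f : EuclideanSpace ℝ (Fin n) → ℝ, Measurable f → traceNorm Ω p f < ∞ →
      ∃ F DF, HasTrace Ω Ω p F DF f ∧ gradNorm Ω p DF ≤ C * traceNorm Ω p f ∧
        ∀ A, IsOpen A → (∀ x ∈ A, ∀ y ∈ frontier Ω, δ ≤ dist x y) → ∀ x ∈ A, DF x = 0 := by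
  have hn1 : 1 ≤ n := by omega
  have hp0 : 0 < p := by linarith
  obtain ⟨hΩL, hΩc⟩ := hΩ
  have hne := frontier_nonempty_of_isBounded hn1 hΩc.nonempty hΩL.isBounded
  have hfin := isFiniteMeasure_surfaceMeasure hn1 hΩL
  have hclb : Bornology.IsBounded (closure Ω) := hΩL.isBounded.closure
  set d : EuclideanSpace ℝ (Fin n) → ℝ := fun x => Metric.infDist x (frontier Ω) with hd
  have hdiam : ∀ x ∈ closure Ω, ∀ y ∈ frontier Ω, dist x y < Metric.diam (closure Ω) + 1 :=
    fun x hx y hy => by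
      linarith [Metric.dist_le_diam_of_mem hclb hx (frontier_subset_closure hy)]
  set R := Metric.diam (closure Ω) + 1 with hR
  have hR1 : 1 ≤ R := by linarith [Metric.diam_nonneg (s := closure Ω)]
  have hdR : ∀ x ∈ closure Ω, d x ≤ R := fun x hx => by
    obtain ⟨y, hy⟩ := hne
    exact (Metric.infDist_le_dist_of_mem hy).trans (hdiam x hx y hy).le
  have hdpos : ∀ x ∈ Ω, 0 < d x := fun x hx => by
    refine (isClosed_frontier.notMem_iff_infDist_pos hne).1 fun h => ?_
    rw [hΩL.isOpen.frontier_eq] at h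
    exact h.2 hx
  have hd0 : ∀ x ∈ frontier Ω, d x = 0 := fun x hx => Metric.infDist_zero_of_mem hx
  have hdc : Continuous d := Metric.continuous_infDist_pt _
  set m := n - 1 with hm
  have hnm : (n : ℝ) = (m : ℝ) + 1 := by rw [hm]; exact_mod_cast (Nat.sub_add_cancel hn1).symm
  -- An integer decay exponent that is at least `p + 2m`, as `kernel_bound_mul_le` requires.
  set M := ⌈p⌉₊ + 2 * m with hMdef
  have hM : p + 2 * m ≤ M := by
    rw [hMdef]; push_cast; linarith [Nat.le_ceil p]
  obtain ⟨hz, B, hBpos, hB⟩ := exists_avgKernel_surfaceMeasure_le hn1 hΩL hne M R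
  obtain ⟨C₁, hC₁⟩ := exists_boundaryExt_le_extMajorant (n := n) M m hp.le hM hBpos.le hδ
  obtain ⟨C₂, hC₂⟩ := exists_lintegral_oscillation_le hn1 hp
  obtain ⟨C₃, hC₃⟩ := exists_setLIntegral_weighted_le hn1 (s := Ω) (R := R)
  set S := surfaceMeasure Ω with hS
  have hSae : ∀ᵐ y ∂S, y ∈ frontier Ω := ae_restrict_mem isClosed_frontier.measurableSet
  refine ⟨(C₁ * (C₂ + C₃)) ^ (1 / p), fun f hf hft => ?_⟩
  have hα : (n : ℝ) - 1 + (1 - 1 / p) * p = (m : ℝ) + (p - 1) := by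
    rw [hnm]; field_simp; ring
  obtain ⟨hs1, hs2⟩ := traceNorm_rpow_ge (Ω := Ω) hp0 f
  simp only [hα] at hs1
  set T := traceNorm Ω p f with hT
  have hTp : T ^ p ≠ ∞ := by finiteness
  have hfLp : MemLp f (ENNReal.ofReal p) S :=
    ⟨hf.aestronglyMeasurable, lt_of_le_of_lt le_self_add hft⟩
  have hfi : Integrable f S := hfLp.integrable (by simpa using hp.le)
  set G : EuclideanSpace ℝ (Fin n) → ℝ≥0∞ := fun x => C₁ * extMajorant S m p f x with hG
  have hGint : ∫⁻ x in Ω, G x ≤ C₁ * ((C₂ + C₃) * T ^ p) := by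
    rw [hG, lintegral_const_mul' _ _ ENNReal.coe_ne_top]
    gcongr
    simp only [extMajorant]
    rw [lintegral_add_right _ (by
      refine Measurable.lintegral_prod_right' (f := fun q : EuclideanSpace ℝ (Fin n) ×
        EuclideanSpace ℝ (Fin n) => ENNReal.ofReal ((dist q.1 q.2 ^ m)⁻¹) * ‖f q.2‖ₑ ^ p) ?_
      fun_prop), add_mul]
    refine add_le_add ?_ ?_
    · refine (setLIntegral_le_lintegral _ _).trans ((hC₂ S f hf).trans ?_)
      gcongr
    · refine (hC₃ S f p hf ?_).trans ?_
      · filter_upwards [hSae] with y hy x hx using hdiam x (subset_closure hx) y hy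
      · gcongr
  have hGfin : ∫⁻ x in Ω, G x ≠ ∞ := ne_top_of_le_ne_top (by finiteness) hGint
  set E := boundaryExt Ω M δ f with hE
  have hbd : ∀ x ∈ Ω, ∀ ε : ℝ, ε ≤ 1 → ‖gradient (E ε) x‖ₑ ^ p ≤ G x ∧ ‖E ε x‖ₑ ^ p ≤ G x := by
    intro x hx ε hε
    have hρ : 0 < max (d x) ε := lt_max_of_lt_left (hdpos x hx)
    refine hC₁ Ω f x ε _ hfi rfl hρ
      (hB x _ hρ (le_max_left _ _) (max_le (hdR x (subset_closure hx)) (hε.trans hR1))) ?_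
    filter_upwards [hSae] with y hy hxy
    rw [hΩL.isOpen.frontier_eq, ← hxy] at hy
    exact hy.2 hx
  have hlip : ∀ ε : ℝ, 0 < ε → ε ≤ 1 → ∃ L, LipschitzOnWith L (E ε) (closure Ω) :=
    fun ε hε hε1 => exists_lipschitzOnWith_boundaryExt hδ hε (hε1.trans hR1) hBpos.le hB hdR hfi
  -- Where `d > ε` the truncation of the scale is inactive; local properties of `E 0` are inherited
  -- from the Lipschitz functions `E ε`.
  have heq : ∀ ε x, ε < d x → E 0 x = E ε x := by
    intro ε x h
    simp only [hE, boundaryExt]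
    rw [max_eq_left Metric.infDist_nonneg, max_eq_left (show ε ≤ d x from h.le)]
  have hopen : ∀ ε, IsOpen {x | ε < d x} := fun ε => isOpen_lt continuous_const hdc
  have heqn : ∀ ε x, ε < d x → E 0 =ᶠ[𝓝 x] E ε := fun ε x h => by
    filter_upwards [(hopen ε).mem_nhds h] with z hz using heq ε z hz
  have hcont0 : ContinuousOn (E 0) Ω := by
    intro x hx
    have hx2 : min (d x / 2) 1 < d x := (min_le_left _ _).trans_lt (half_lt_self (hdpos x hx))
    obtain ⟨L, hL⟩ := hlip (min (d x / 2) 1) (lt_min (half_pos (hdpos x hx)) one_pos)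
      (min_le_right _ _)
    exact (((hL.continuousOn.mono subset_closure).continuousAt (hΩL.isOpen.mem_nhds hx)).congr
      (heqn _ x hx2).symm).continuousWithinAt
  have hmeas0 : AEStronglyMeasurable (E 0) (volume.restrict Ω) :=
    hcont0.aestronglyMeasurable hΩL.isOpen.measurableSet
  have hmeasg : ∀ ε, AEStronglyMeasurable (gradient (E ε)) (volume.restrict Ω) :=
    fun ε => (measurable_gradient _).aestronglyMeasurable
  have haeΩ : ∀ᵐ x ∂(volume.restrict Ω), x ∈ Ω := ae_restrict_mem hΩL.isOpen.measurableSet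
  have hsob0 : MemSobolev Ω p (E 0) (gradient (E 0)) := by
    refine ⟨⟨hmeas0, ?_⟩, ⟨hmeasg 0, ?_⟩, ?_⟩
    · rw [eLpNorm_ofReal_eq hp0]
      refine ENNReal.rpow_lt_top_of_nonneg (by positivity) (ne_top_of_le_ne_top hGfin ?_)
      exact lintegral_mono_ae (haeΩ.mono fun x hx => (hbd x hx 0 zero_le_one).2)
    · rw [eLpNorm_ofReal_eq hp0]
      refine ENNReal.rpow_lt_top_of_nonneg (by positivity) (ne_top_of_le_ne_top hGfin ?_)
      exact lintegral_mono_ae (haeΩ.mono fun x hx => (hbd x hx 0 zero_le_one).1)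
    · intro φ hφ hφc hφΩ v
      -- The compact support of the test function stays a positive distance away from the boundary,
      -- so `E 0` may be replaced by some `E ε` near it.
      obtain ⟨ε, hε, hε1, hεφ⟩ : ∃ ε, 0 < ε ∧ ε ≤ 1 ∧ ∀ x ∈ tsupport φ, ε < d x := by
        rcases (tsupport φ).eq_empty_or_nonempty with h | h
        · exact ⟨1, one_pos, le_rfl, by simp [h]⟩
        · obtain ⟨x₀, hx₀, hmin⟩ := hφc.exists_isMinOn h hdc.continuousOn
          have hpos := hdpos x₀ (hφΩ hx₀)
          refine ⟨min (d x₀ / 2) 1, lt_min (half_pos hpos) one_pos, min_le_right _ _,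
            fun x hx => ?_⟩
          exact (min_le_left _ _).trans_lt ((half_lt_self hpos).trans_le (hmin hx))
      obtain ⟨L, hL⟩ := hlip ε hε hε1
      obtain ⟨h, hh, hEh⟩ := hL.extend_real
      refine setIntegral_mul_fderiv_eq (V := Ω ∩ {x | ε < d x}) (hΩL.isOpen.inter (hopen ε))
        Set.inter_subset_left hh (fun x hx => ?_) hφ hφc (fun x hx => ⟨hφΩ hx, hεφ x hx⟩) v
      rw [heq ε x hx.2]
      exact hEh (subset_closure hx.1)
  set ε : ℕ → ℝ := fun k => 1 / ((k : ℝ) + 1) with hεdef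
  have hε0 : ∀ k, 0 < ε k := fun k => by positivity
  have hε1 : ∀ k, ε k ≤ 1 := fun k => by
    rw [hεdef]; exact (div_le_one (by positivity)).2 (by simp)
  have hεlim : Tendsto ε atTop (𝓝 0) := tendsto_one_div_add_atTop_nhds_zero_nat
  have hlimae : ∀ᵐ x ∂(volume.restrict Ω), ∀ᶠ k in atTop, ε k < d x :=
    haeΩ.mono fun x hx => hεlim.eventually_lt_const (hdpos x hx)
  have hsobk : ∀ k, MemSobolev Ω p (E (ε k)) (gradient (E (ε k))) := fun k => by
    obtain ⟨L, hL⟩ := hlip (ε k) (hε0 k) (hε1 k)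
    exact memSobolev_of_lipschitzOnWith hΩL.isOpen hΩL.isBounded (hL.mono subset_closure) p
  refine ⟨E 0, gradient (E 0), ⟨hsob0, fun k => E (ε k), fun k => gradient (E (ε k)),
    fun k => ⟨hsobk k, ?_⟩, ?_, ?_, ?_⟩, ?_, ?_⟩
  · obtain ⟨L, hL⟩ := hlip (ε k) (hε0 k) (hε1 k)
    exact hL.continuousOn
  · refine tendsto_eLpNorm_sub_of_dominated hp.le (fun k => (hsobk k).memLp.1) hmeas0
      (fun k => haeΩ.mono fun x hx => (hbd x hx _ (hε1 k)).2)
      (haeΩ.mono fun x hx => (hbd x hx 0 zero_le_one).2) hGfin ?_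
    filter_upwards [hlimae] with x hx
    filter_upwards [hx] with k hk using (heq _ x hk).symm
  · refine tendsto_eLpNorm_sub_of_dominated hp.le (fun k => hmeasg _) (hmeasg 0)
      (fun k => haeΩ.mono fun x hx => (hbd x hx _ (hε1 k)).1)
      (haeΩ.mono fun x hx => (hbd x hx 0 zero_le_one).1) hGfin ?_
    filter_upwards [hlimae] with x hx
    filter_upwards [hx] with k hk using (gradient_congr_of_eventuallyEq (heqn _ x hk)).symm
  -- On the boundary `d = 0`: the cutoff is one and `E (ε k)` is the average at scale `ε k`. The
  -- factor `ε k ^ (p - 1)` tends to zero because `p > 1`.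
  · have hle : ∀ k, eLpNorm (E (ε k) - f) (ENNReal.ofReal p) S
        ≤ (ENNReal.ofReal (B * ε k ^ (p - 1)) * T ^ p) ^ (1 / p) := by
      intro k
      rw [eLpNorm_ofReal_eq hp0]
      gcongr
      refine le_trans ?_ (mul_le_mul_right hs1 _)
      rw [← lintegral_const_mul' _ _ ENNReal.ofReal_ne_top]
      refine lintegral_mono_ae ?_
      filter_upwards [hSae] with x hx
      have hEx : E (ε k) x = kernelAvg S M f (ε k) x := by
        have h0 : Metric.infDist x (frontier Ω) = 0 := hd0 x hx
        simp only [hE, boundaryExt, h0, zero_div, sub_zero]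
        rw [max_eq_right zero_le_one, one_mul, max_eq_right (hε0 k).le]
      rw [Pi.sub_apply, hEx, enorm_sub_rev]
      refine enorm_sub_kernelAvg_rpow_le_seminorm (hε0 k) hp.le hM
        (hB x (ε k) (hε0 k) ?_ ((hε1 k).trans hR1)) hBpos.le hfi
      exact (hd0 x hx).le.trans (hε0 k).le
    refine tendsto_of_tendsto_of_tendsto_of_le_of_le tendsto_const_nhds ?_ (fun _ => zero_le) hle
    have h1 : Tendsto (fun k => B * ε k ^ (p - 1)) atTop (𝓝 (B * 0 ^ (p - 1))) :=
      (hεlim.rpow_const (Or.inr (by linarith))).const_mul B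
    rw [Real.zero_rpow (by linarith), mul_zero] at h1
    have h2 := (ENNReal.Tendsto.mul_const (ENNReal.tendsto_ofReal h1) (Or.inr hTp)).ennrpow_const
      (1 / p)
    simpa [hp0] using h2
  · rw [gradNorm, eLpNorm_ofReal_eq hp0, ENNReal.coe_rpow_of_nonneg _ (by positivity)]
    calc _ ≤ (C₁ * ((C₂ + C₃) * T ^ p)) ^ (1 / p) := by
          gcongr
          refine le_trans ?_ hGint
          exact lintegral_mono_ae (haeΩ.mono fun x hx => (hbd x hx 0 zero_le_one).1)
      _ = _ := by
          rw [← mul_assoc, ENNReal.mul_rpow_of_nonneg _ _ (by positivity), ← ENNReal.rpow_mul,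
            mul_one_div_cancel hp0.ne', ENNReal.rpow_one]
          push_cast; rfl
  · intro A hA hAd x hx
    have : E 0 =ᶠ[𝓝 x] fun _ => 0 := by
      filter_upwards [hA.mem_nhds hx] with z hz
      have hdz : δ ≤ d z := (Metric.le_infDist hne).2 fun y hy => hAd z hz y hy
      simp only [hE, boundaryExt]
      rw [max_eq_left, zero_mul]
      have : 1 ≤ Metric.infDist z (frontier Ω) / δ := (one_le_div hδ).2 hdz
      linarith
    rw [gradient_congr_of_eventuallyEq this]
    simp

/-- Functions in the trace space extend to Sobolev functions, with a bound on the gradient; the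
extension can be chosen to be locally constant away from the boundary. -/
theorem exists_extension (hn : 2 ≤ n) {Ω : Set (EuclideanSpace ℝ (Fin n))}
    (hΩ : IsLipschitzDomain Ω) {p : ℝ} (hp : 1 < p) {δ : ℝ} (hδ : 0 < δ) :
    ∃ C : ℝ≥0, ∀ f : EuclideanSpace ℝ (Fin n) → ℝ, MemTraceSpaceZeroMean Ω p f →
      ∃ F DF, HasTrace Ω Ω p F DF f ∧ gradNorm Ω p DF ≤ C * traceNorm Ω p f ∧
        ∀ A, IsOpen A → (∀ x ∈ A, ∀ y ∈ frontier Ω, δ ≤ dist x y) → ∀ x ∈ A, DF x = 0 := by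
  obtain ⟨C, hC⟩ := exists_extension_of_measurable hn hΩ hp hδ
  refine ⟨C, fun f hf => ?_⟩
  -- Tonelli above asks for measurability; a measurable representative has the same trace norm and
  -- the same trace condition.
  have hm := hf.memLp.1
  have hae := hm.ae_eq_mk
  have hnorm : traceNorm Ω p (hm.mk f) = traceNorm Ω p f := by
    rw [traceNorm, traceNorm, eLpNorm_congr_ae hae.symm]
    congr 1
    rw [slobodeckijSeminorm, slobodeckijSeminorm]
    congr 1
    refine lintegral_congr_ae ?_
    filter_upwards [hae] with x hx
    refine lintegral_congr_ae ?_
    filter_upwards [hae] with y hy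
    rw [hx, hy]
  obtain ⟨F, DF, ⟨hF, w, Dw, hw, h1, h2, h3⟩, hgrad, hzero⟩ := hC (hm.mk f)
    hm.stronglyMeasurable_mk.measurable
    (by rw [hnorm]; exact ENNReal.add_lt_top.2 ⟨hf.memLp.2, hf.seminorm_lt_top⟩)
  refine ⟨F, DF, ⟨hF, w, Dw, hw, h1, h2, ?_⟩, hnorm ▸ hgrad, hzero⟩
  refine h3.congr fun k => eLpNorm_congr_ae ?_
  filter_upwards [hae] with x hx
  simp [hx]

end ExtensionTheorem

/-! ### Growth of the energy -/

section Energy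

variable {n : ℕ}

theorem lintegral_Ioc_rpow {r : ℝ} (hr : -1 < r) {E : ℝ} (hE : 0 ≤ E) :
    ∫⁻ ξ in Set.Ioc 0 E, ENNReal.ofReal (ξ ^ r) = ENNReal.ofReal (E ^ (r + 1) / (r + 1)) := by
  have hi : IntegrableOn (fun ξ : ℝ => ξ ^ r) (Set.Ioc 0 E) :=
    (intervalIntegrable_iff_integrableOn_Ioc_of_le hE).1 (intervalIntegral.intervalIntegrable_rpow' hr)
  rw [← ofReal_integral_eq_lintegral_ofReal hi
    (ae_restrict_of_forall_mem measurableSet_Ioc fun ξ hξ => Real.rpow_nonneg hξ.1.le _),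
    ← intervalIntegral.integral_of_le hE, integral_rpow (Or.inl hr),
    Real.zero_rpow (by linarith), sub_zero]

theorem rpow_div_mul_self {ξ E₀ : ℝ} (hξ : 0 < ξ) (hE₀ : 0 < E₀) (p : ℝ) :
    (ξ / E₀) ^ (p - 2) * ξ = (E₀ ^ (p - 2))⁻¹ * ξ ^ (p - 1) := by
  rw [Real.div_rpow hξ.le hE₀.le, show p - 1 = (p - 2) + 1 by ring, Real.rpow_add_one hξ.ne']
  field_simp

theorem lintegral_Ioc_mul_rpow {p : ℝ} (hp : 0 < p) {a : ℝ} (ha : 0 ≤ a)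
    (v : EuclideanSpace ℝ (Fin n)) :
    ∫⁻ ξ in Set.Ioc 0 ‖v‖, ENNReal.ofReal (a * ξ ^ (p - 1))
      = ENNReal.ofReal (a / p) * ‖v‖ₑ ^ p := by
  simp_rw [ENNReal.ofReal_mul ha]
  rw [lintegral_const_mul' _ _ ENNReal.ofReal_ne_top, lintegral_Ioc_rpow (by linarith)
    (norm_nonneg v), sub_add_cancel, ← ofReal_norm, ENNReal.ofReal_rpow_of_nonneg (norm_nonneg _)
    hp.le, ← ENNReal.ofReal_mul ha, ← ENNReal.ofReal_mul (by positivity)]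
  congr 1; ring

theorem le_energyDensity {σ : EuclideanSpace ℝ (Fin n) → ℝ → ℝ≥0∞} {x : EuclideanSpace ℝ (Fin n)}
    {p lo E₀ : ℝ} (hp : 0 < p) (hlo : 0 ≤ lo) (hE₀ : 0 < E₀)
    (h : ∀ E : ℝ, 0 < E → ENNReal.ofReal (lo * (E / E₀) ^ (p - 2)) ≤ σ x E)
    (v : EuclideanSpace ℝ (Fin n)) :
    ENNReal.ofReal (lo * (E₀ ^ (p - 2))⁻¹ / p) * ‖v‖ₑ ^ p ≤ energyDensity σ x ‖v‖ := by
  rw [← lintegral_Ioc_mul_rpow hp (by positivity), energyDensity]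
  refine setLIntegral_mono' measurableSet_Ioc fun ξ hξ => ?_
  rw [mul_assoc, ← rpow_div_mul_self hξ.1 hE₀, ← mul_assoc, ENNReal.ofReal_mul' hξ.1.le]
  gcongr
  exact h ξ hξ.1

/-- For `p ≥ 2` the constant part of the growth bound integrates to `hi * E² / 2`, absorbed through
`E² ≤ 1 + E^p`. For `p < 2` the pure power is enough. -/
theorem energyDensity_le {σ : EuclideanSpace ℝ (Fin n) → ℝ → ℝ≥0∞} {x : EuclideanSpace ℝ (Fin n)}
    {p hi E₀ : ℝ} (hp : 0 < p) (hhi : 0 ≤ hi) (hE₀ : 0 < E₀)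
    (h : ∀ E : ℝ, 0 < E → (2 ≤ p → σ x E ≤ ENNReal.ofReal (hi * (1 + (E / E₀) ^ (p - 2)))) ∧
      (p < 2 → σ x E ≤ ENNReal.ofReal (hi * (E / E₀) ^ (p - 2))))
    (v : EuclideanSpace ℝ (Fin n)) :
    energyDensity σ x ‖v‖
      ≤ (ENNReal.ofReal (hi / 2) + ENNReal.ofReal (hi * (E₀ ^ (p - 2))⁻¹ / p)) *
        (1 + ‖v‖ₑ ^ p) := by
  set a := ENNReal.ofReal (hi * (E₀ ^ (p - 2))⁻¹ / p) * ‖v‖ₑ ^ p with ha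
  have ha' : a = ∫⁻ ξ in Set.Ioc 0 ‖v‖, ENNReal.ofReal (hi * (E₀ ^ (p - 2))⁻¹ * ξ ^ (p - 1)) :=
    (lintegral_Ioc_mul_rpow hp (by positivity) v).symm
  have ha1 : a ≤ ENNReal.ofReal (hi * (E₀ ^ (p - 2))⁻¹ / p) * (1 + ‖v‖ₑ ^ p) := by
    rw [ha]; gcongr; exact le_add_self
  rw [add_mul]
  rcases le_or_gt 2 p with h2 | h2
  · have hv : ‖v‖ₑ ^ (2 : ℝ) ≤ 1 + ‖v‖ₑ ^ p := by
      rcases le_total ‖v‖ₑ 1 with h1 | h1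
      · exact (ENNReal.rpow_le_one h1 (by norm_num)).trans le_self_add
      · exact (ENNReal.rpow_le_rpow_of_exponent_le h1 h2).trans le_add_self
    have hb := lintegral_Ioc_mul_rpow (p := 2) two_pos hhi v
    refine le_trans ?_ (add_le_add (mul_le_mul_right hv _) ha1)
    rw [← hb, ha', ← lintegral_add_left (by fun_prop), energyDensity]
    refine setLIntegral_mono' measurableSet_Ioc fun ξ hξ => ?_
    have hξ0 : 0 < ξ := hξ.1
    rw [← ENNReal.ofReal_add (by positivity) (by positivity), mul_assoc hi _ (ξ ^ (p - 1)),
      ← rpow_div_mul_self hξ0 hE₀]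
    refine (mul_le_mul_left (((h ξ hξ0).1 h2)) _).trans (le_of_eq ?_)
    rw [← ENNReal.ofReal_mul' hξ0.le]
    congr 1
    rw [show (2 : ℝ) - 1 = 1 by norm_num, Real.rpow_one]; ring
  · refine le_trans ?_ (le_add_left ha1)
    rw [ha', energyDensity]
    refine setLIntegral_mono' measurableSet_Ioc fun ξ hξ => ?_
    rw [mul_assoc, ← rpow_div_mul_self hξ.1 hE₀, ← mul_assoc, ENNReal.ofReal_mul' hξ.1.le]
    gcongr
    exact (h ξ hξ.1).2 h2

variable {U : Set (EuclideanSpace ℝ (Fin n))} {σ : EuclideanSpace ℝ (Fin n) → ℝ → ℝ≥0∞}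
  {p lo hi E₀ : ℝ}

theorem le_energyOn (hp : 0 < p) (hlo : 0 ≤ lo) (hE₀ : 0 < E₀)
    (h : HasGrowthOn U p lo hi E₀ σ) (Du : EuclideanSpace ℝ (Fin n) → EuclideanSpace ℝ (Fin n)) :
    ENNReal.ofReal (lo * (E₀ ^ (p - 2))⁻¹ / p) * gradNorm U p Du ^ p ≤ energyOn U σ Du := by
  rw [gradNorm, eLpNorm_ofReal_rpow hp, ← lintegral_const_mul' _ _ ENNReal.ofReal_ne_top]
  refine lintegral_mono_ae ?_
  filter_upwards [h] with x hx
  exact le_energyDensity hp hlo hE₀ (fun E hE => (hx E hE).1) (Du x)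

theorem energyOn_le (hp : 0 < p) (hhi : 0 ≤ hi) (hE₀ : 0 < E₀)
    (h : HasGrowthOn U p lo hi E₀ σ) (Du : EuclideanSpace ℝ (Fin n) → EuclideanSpace ℝ (Fin n)) :
    energyOn U σ Du
      ≤ (ENNReal.ofReal (hi / 2) + ENNReal.ofReal (hi * (E₀ ^ (p - 2))⁻¹ / p)) *
        (volume U + gradNorm U p Du ^ p) := by
  rw [gradNorm, eLpNorm_ofReal_rpow hp]
  calc energyOn U σ Du
      ≤ ∫⁻ x in U, (ENNReal.ofReal (hi / 2) + ENNReal.ofReal (hi * (E₀ ^ (p - 2))⁻¹ / p)) *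
        (1 + ‖Du x‖ₑ ^ p) := by
        refine lintegral_mono_ae ?_
        filter_upwards [h] with x hx
        exact energyDensity_le hp hhi hE₀ (fun E hE => (hx E hE).2) (Du x)
    _ = _ := by
        rw [lintegral_const_mul' _ _ (by finiteness), lintegral_add_left measurable_const]
        simp

/-- True for every `σ`, even infinite: at zero field the density is an integral over an empty
interval. -/
theorem energyOn_eq_zero (hU : MeasurableSet U)
    {Du : EuclideanSpace ℝ (Fin n) → EuclideanSpace ℝ (Fin n)} (h : ∀ x ∈ U, Du x = 0) :
    energyOn U σ Du = 0 := by
  rw [energyOn, setLIntegral_congr_fun (g := fun _ => 0) hU fun x hx => by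
    simp [h x hx, energyDensity]]
  simp

theorem gradNorm_mono {V : Set (EuclideanSpace ℝ (Fin n))} (hVU : V ⊆ U)
    (Du : EuclideanSpace ℝ (Fin n) → EuclideanSpace ℝ (Fin n)) :
    gradNorm V p Du ≤ gradNorm U p Du :=
  eLpNorm_mono_measure _ (Measure.restrict_mono hVU le_rfl)

theorem MemSobolev.mono {V : Set (EuclideanSpace ℝ (Fin n))} (hVU : V ⊆ U)
    {u : EuclideanSpace ℝ (Fin n) → ℝ}
    {Du : EuclideanSpace ℝ (Fin n) → EuclideanSpace ℝ (Fin n)} (h : MemSobolev U p u Du) :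
    MemSobolev V p u Du := by
  refine ⟨h.memLp.mono_measure (Measure.restrict_mono hVU le_rfl),
    h.memLp_grad.mono_measure (Measure.restrict_mono hVU le_rfl), fun φ hφ hφc hφV v => ?_⟩
  have h0 : ∀ x, x ∉ V → φ x = 0 := fun x hx => image_eq_zero_of_notMem_tsupport fun h => hx (hφV h)
  have h0' : ∀ x, x ∉ V → fderiv ℝ φ x = 0 := fun x hx =>
    fderiv_of_notMem_tsupport ℝ fun h => hx (hφV h)
  have := h.integral_by_parts φ hφ hφc (hφV.trans hVU) v
  have e1 : ∀ W, V ⊆ W →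
      ∫ x in W, u x * fderiv ℝ φ x v = ∫ x, u x * fderiv ℝ φ x v := fun W hW =>
    setIntegral_eq_integral_of_forall_compl_eq_zero
      fun x hx => by rw [h0' x fun h => hx (hW h)]; simp
  have e2 : ∀ W, V ⊆ W →
      ∫ x in W, inner ℝ (Du x) v * φ x = ∫ x, inner ℝ (Du x) v * φ x := fun W hW =>
    setIntegral_eq_integral_of_forall_compl_eq_zero
      fun x hx => by rw [h0 x fun h => hx (hW h)]; simp
  rw [e1 V subset_rfl, e2 V subset_rfl, ← e1 U hVU, ← e2 U hVU, this]

/-- The boundary condition refers to `∂Ω` for either region, so the approximating sequence is simply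
restricted. This makes the extension admissible in the insulating case. -/
theorem HasTrace.mono {V Ω : Set (EuclideanSpace ℝ (Fin n))} (hVU : V ⊆ U)
    {u f : EuclideanSpace ℝ (Fin n) → ℝ}
    {Du : EuclideanSpace ℝ (Fin n) → EuclideanSpace ℝ (Fin n)} (h : HasTrace U Ω p u Du f) :
    HasTrace V Ω p u Du f := by
  obtain ⟨hu, w, Dw, hw, h1, h2, h3⟩ := h
  have hle : volume.restrict V ≤ volume.restrict U := Measure.restrict_mono hVU le_rfl
  exact ⟨hu.mono hVU, w, Dw,
    fun k => ⟨(hw k).1.mono hVU, (hw k).2.mono (closure_mono hVU)⟩,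
    tendsto_of_tendsto_of_tendsto_of_le_of_le tendsto_const_nhds h1 (fun _ => zero_le)
      fun _ => eLpNorm_mono_measure _ hle,
    tendsto_of_tendsto_of_tendsto_of_le_of_le tendsto_const_nhds h2 (fun _ => zero_le)
      fun _ => eLpNorm_mono_measure _ hle, h3⟩

/-- From an inequality between `p`-th powers to one between norms. -/
theorem exists_rpow_le_mul_one_add (hp : 0 < p) {a b V : ℝ≥0∞} (C₀ : ℝ≥0) (ha : a ≠ 0)
    (hat : a ≠ ∞) (hb : b ≠ ∞) (hV : V ≠ ∞) :
    ∃ C : ℝ≥0, ∀ X T : ℝ≥0∞, a * X ≤ b * (V + (C₀ * T) ^ p) → X ^ (1 / p) ≤ C * (1 + T) := by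
  have hfin : a⁻¹ * (b * (V + (C₀ : ℝ≥0∞) ^ p)) ≠ ∞ := by finiteness
  refine ⟨((a⁻¹ * (b * (V + (C₀ : ℝ≥0∞) ^ p))) ^ (1 / p)).toNNReal, fun X T h => ?_⟩
  rw [ENNReal.coe_toNNReal (by finiteness)]
  have h1 : 1 ≤ (1 + T) ^ p := ENNReal.one_le_rpow le_self_add hp
  have hX : X ≤ a⁻¹ * (b * (V + (C₀ : ℝ≥0∞) ^ p)) * (1 + T) ^ p := by
    calc X = a⁻¹ * (a * X) := by rw [← mul_assoc, ENNReal.inv_mul_cancel ha hat, one_mul]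
      _ ≤ a⁻¹ * (b * (V + (C₀ * T) ^ p)) := by gcongr
      _ ≤ a⁻¹ * (b * (V * (1 + T) ^ p + (C₀ : ℝ≥0∞) ^ p * (1 + T) ^ p)) := by
          rw [ENNReal.mul_rpow_of_nonneg _ _ hp.le]
          gcongr
          · exact le_mul_of_one_le_right' h1
          · exact le_add_self
      _ = _ := by ring
  calc X ^ (1 / p) ≤ (a⁻¹ * (b * (V + (C₀ : ℝ≥0∞) ^ p)) * (1 + T) ^ p) ^ (1 / p) := by gcongr
    _ = _ := by
      rw [ENNReal.mul_rpow_of_nonneg _ _ (by positivity), ← ENNReal.rpow_mul,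
        mul_one_div_cancel hp.ne', ENNReal.rpow_one]

theorem gradNorm_rpow_rpow (hp : 0 < p)
    (Du : EuclideanSpace ℝ (Fin n) → EuclideanSpace ℝ (Fin n)) :
    (gradNorm U p Du ^ p) ^ (1 / p) = gradNorm U p Du := by
  rw [← ENNReal.rpow_mul, mul_one_div_cancel hp.ne', ENNReal.rpow_one]

/-- A field with smaller energy than a controlled one is controlled. -/
theorem exists_gradNorm_le_of_energyOn_le {Ω : Set (EuclideanSpace ℝ (Fin n))}
    (hΩ : Bornology.IsBounded Ω) (hp : 0 < p) (hlo : 0 < lo) (hhi : 0 ≤ hi) (hE₀ : 0 < E₀)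
    (C₀ : ℝ≥0) :
    ∃ C : ℝ≥0, ∀ (U : Set (EuclideanSpace ℝ (Fin n)))
      (σ : EuclideanSpace ℝ (Fin n) → ℝ → ℝ≥0∞)
      (Du DF : EuclideanSpace ℝ (Fin n) → EuclideanSpace ℝ (Fin n)) (T : ℝ≥0∞),
      U ⊆ Ω → HasGrowthOn U p lo hi E₀ σ → gradNorm Ω p DF ≤ C₀ * T →
      energyOn U σ Du ≤ energyOn U σ DF → gradNorm U p Du ≤ C * (1 + T) := by
  -- The measure of `U` is replaced by that of `Ω`, so that the constant can be fixed before `U` and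
  -- `σ`.
  obtain ⟨C, hC⟩ := exists_rpow_le_mul_one_add hp
    (a := ENNReal.ofReal (lo * (E₀ ^ (p - 2))⁻¹ / p))
    (b := ENNReal.ofReal (hi / 2) + ENNReal.ofReal (hi * (E₀ ^ (p - 2))⁻¹ / p))
    (V := volume Ω) C₀ (ENNReal.ofReal_pos.2 (by positivity)).ne' ENNReal.ofReal_ne_top
    (by finiteness) hΩ.measure_lt_top.ne
  refine ⟨C, fun U σ Du DF T hU hσ hDF hle => ?_⟩
  rw [← gradNorm_rpow_rpow hp]
  refine hC _ _ (((le_energyOn hp hlo.le hE₀ hσ Du).trans hle).trans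
    ((energyOn_le hp hhi hE₀ hσ DF).trans ?_))
  gcongr
  exact (gradNorm_mono hU DF).trans hDF

/-- The two-phase version of `exists_gradNorm_le_of_energyOn_le`. -/
theorem exists_gradNorm_add_le_of_energyOn_le {Ω : Set (EuclideanSpace ℝ (Fin n))}
    (hΩ : Bornology.IsBounded Ω) (hp : 0 < p) (hlo : 0 < lo) (hhi : 0 ≤ hi) (hE₀ : 0 < E₀)
    {q lo' hi' E₀' : ℝ} (hq : 0 < q) (hlo' : 0 < lo') (hE₀' : 0 < E₀') (C₀ : ℝ≥0) :
    ∃ C : ℝ≥0, ∀ (U A : Set (EuclideanSpace ℝ (Fin n)))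
      (σ : EuclideanSpace ℝ (Fin n) → ℝ → ℝ≥0∞)
      (Du DF : EuclideanSpace ℝ (Fin n) → EuclideanSpace ℝ (Fin n)) (T : ℝ≥0∞),
      U ⊆ Ω → HasGrowthOn U p lo hi E₀ σ → HasGrowthOn A q lo' hi' E₀' σ →
      gradNorm Ω p DF ≤ C₀ * T → energyOn U σ Du + energyOn A σ Du ≤ energyOn U σ DF →
      (gradNorm U p Du ^ p + gradNorm A q Du ^ q) ^ (1 / p) ≤ C * (1 + T) := by
  set a₁ := ENNReal.ofReal (lo * (E₀ ^ (p - 2))⁻¹ / p)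
  set a₂ := ENNReal.ofReal (lo' * (E₀' ^ (q - 2))⁻¹ / q)
  have ha₁ : a₁ ≠ 0 := (ENNReal.ofReal_pos.2 (by positivity)).ne'
  have ha₂ : a₂ ≠ 0 := (ENNReal.ofReal_pos.2 (by positivity)).ne'
  -- Both phases are coercive with the smaller of the two constants; the comparison field costs
  -- energy only in `U`.
  obtain ⟨C, hC⟩ := exists_rpow_le_mul_one_add hp (a := min a₁ a₂)
    (b := ENNReal.ofReal (hi / 2) + ENNReal.ofReal (hi * (E₀ ^ (p - 2))⁻¹ / p))
    (V := volume Ω) C₀ (by rcases min_choice a₁ a₂ with h | h <;> rw [h] <;> assumption)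
    ((min_le_left _ _).trans_lt ENNReal.ofReal_lt_top).ne
    (by finiteness) hΩ.measure_lt_top.ne
  refine ⟨C, fun U A σ Du DF T hU hσ hσA hDF hle => hC _ _ ?_⟩
  calc min a₁ a₂ * (gradNorm U p Du ^ p + gradNorm A q Du ^ q)
      ≤ a₁ * gradNorm U p Du ^ p + a₂ * gradNorm A q Du ^ q := by
        rw [mul_add]
        gcongr
        · exact min_le_left _ _
        · exact min_le_right _ _
    _ ≤ energyOn U σ Du + energyOn A σ Du :=
        add_le_add (le_energyOn hp hlo.le hE₀ hσ Du) (le_energyOn hq hlo'.le hE₀' hσA Du)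
    _ ≤ _ := hle.trans ((energyOn_le hp hhi hE₀ hσ DF).trans (by
        gcongr
        exact (gradNorm_mono hU DF).trans hDF))

end Energy

end

/-! ### The four energy comparisons -/

theorem lemma3p1 {n : ℕ} (hn : 2 ≤ n) (Ω : Set (EuclideanSpace ℝ (Fin n)))
    (hΩ : IsLipschitzDomain Ω) (p : ℝ) (hp : 1 < p)
    (lo hi E₀ : ℝ) (hlo : 0 < lo) (hlohi : lo ≤ hi) (hE₀ : 0 < E₀) :
    -- (i) no inner material
    (∃ C : ℝ≥0, ∀ (σ : EuclideanSpace ℝ (Fin n) → ℝ → ℝ≥0∞)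
      (f u : EuclideanSpace ℝ (Fin n) → ℝ)
      (Du : EuclideanSpace ℝ (Fin n) → EuclideanSpace ℝ (Fin n)),
      IsCaratheodoryOn Ω σ → HasGrowthOn Ω p lo hi E₀ σ → HasStrongMonotonicityOn Ω p σ →
      MemTraceSpaceZeroMean Ω p f → IsTwoPhaseMinimizer Ω ∅ p p σ f u Du →
      gradNorm Ω p Du ≤ C * (1 + traceNorm Ω p f)) ∧
    -- (ii) inner material with growth exponent `q`
    (∀ q : ℝ, 1 < q → ∀ lo' hi' E₀' : ℝ, 0 < lo' → lo' ≤ hi' → 0 < E₀' → ∀ δ : ℝ, 0 < δ →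
      ∃ C : ℝ≥0, ∀ (A : Set (EuclideanSpace ℝ (Fin n)))
      (σ : EuclideanSpace ℝ (Fin n) → ℝ → ℝ≥0∞)
      (f u : EuclideanSpace ℝ (Fin n) → ℝ)
      (Du : EuclideanSpace ℝ (Fin n) → EuclideanSpace ℝ (Fin n)),
      IsInnerPhase Ω A → (∀ x ∈ A, ∀ y ∈ frontier Ω, δ ≤ dist x y) →
      IsCaratheodoryOn (outerPhase Ω A) σ → HasGrowthOn (outerPhase Ω A) p lo hi E₀ σ →
      HasStrongMonotonicityOn (outerPhase Ω A) p σ →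
      IsCaratheodoryOn A σ → HasGrowthOn A q lo' hi' E₀' σ → HasStrongMonotonicityOn A q σ →
      MemTraceSpaceZeroMean Ω p f → IsTwoPhaseMinimizer Ω A p q σ f u Du →
      gradNorm (outerPhase Ω A) p Du ≤
          (gradNorm (outerPhase Ω A) p Du ^ p + gradNorm A q Du ^ q) ^ (1 / p) ∧
      gradNorm A q Du ^ (q / p) ≤
          (gradNorm (outerPhase Ω A) p Du ^ p + gradNorm A q Du ^ q) ^ (1 / p) ∧
      (gradNorm (outerPhase Ω A) p Du ^ p + gradNorm A q Du ^ q) ^ (1 / p) ≤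
          C * (1 + traceNorm Ω p f)) ∧
    -- (iii) perfect insulator in `A`
    (∃ C : ℝ≥0, ∀ (A : Set (EuclideanSpace ℝ (Fin n)))
      (σ : EuclideanSpace ℝ (Fin n) → ℝ → ℝ≥0∞)
      (f u : EuclideanSpace ℝ (Fin n) → ℝ)
      (Du : EuclideanSpace ℝ (Fin n) → EuclideanSpace ℝ (Fin n)),
      IsInnerPhase Ω A →
      IsCaratheodoryOn (outerPhase Ω A) σ → HasGrowthOn (outerPhase Ω A) p lo hi E₀ σ →
      HasStrongMonotonicityOn (outerPhase Ω A) p σ → IsPEI A σ →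
      MemTraceSpaceZeroMean Ω p f → IsPEIMinimizer Ω A p σ f u Du →
      gradNorm (outerPhase Ω A) p Du ≤ C * (1 + traceNorm Ω p f)) ∧
    -- (iv) perfect conductor in `A`
    (∀ δ : ℝ, 0 < δ → ∃ C : ℝ≥0, ∀ (A : Set (EuclideanSpace ℝ (Fin n)))
      (σ : EuclideanSpace ℝ (Fin n) → ℝ → ℝ≥0∞)
      (f u : EuclideanSpace ℝ (Fin n) → ℝ)
      (Du : EuclideanSpace ℝ (Fin n) → EuclideanSpace ℝ (Fin n)),
      IsInnerPhase Ω A → (∀ x ∈ A, ∀ y ∈ frontier Ω, δ ≤ dist x y) →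
      IsCaratheodoryOn (outerPhase Ω A) σ → HasGrowthOn (outerPhase Ω A) p lo hi E₀ σ →
      HasStrongMonotonicityOn (outerPhase Ω A) p σ → IsPEC A σ →
      MemTraceSpaceZeroMean Ω p f → IsPECMinimizer Ω A p σ f u Du →
      gradNorm (outerPhase Ω A) p Du ≤ C * (1 + traceNorm Ω p f)) := by
  have hp0 : 0 < p := by linarith
  have hhi : 0 ≤ hi := by linarith
  have hΩb : Bornology.IsBounded Ω := hΩ.1.isBounded
  have hB : ∀ A, outerPhase Ω A ⊆ Ω := fun A => Set.sdiff_subset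
  refine ⟨?_, ?_, ?_, ?_⟩
  -- There is no inclusion to avoid, so the cutoff distance is arbitrary and is set to one.
  · obtain ⟨C₀, hC₀⟩ := exists_extension hn hΩ hp one_pos
    obtain ⟨C, hC⟩ := exists_gradNorm_le_of_energyOn_le hΩb hp0 hlo hhi hE₀ C₀
    refine ⟨C, fun σ f u Du _ hσ _ hf hu => ?_⟩
    obtain ⟨F, DF, hF, hDF, -⟩ := hC₀ f hf
    have hle := hu.2 F DF (Or.inl hF)
    have h0 : outerPhase Ω ∅ = Ω := by simp [outerPhase]
    simp only [h0, energyOn, Measure.restrict_empty, lintegral_zero_measure, add_zero] at hle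
    exact hC Ω σ Du DF _ subset_rfl hσ hDF hle
  · intro q hq lo' hi' E₀' hlo' _ hE₀' δ hδ
    have hq0 : 0 < q := by linarith
    obtain ⟨C₀, hC₀⟩ := exists_extension hn hΩ hp hδ
    obtain ⟨C, hC⟩ := exists_gradNorm_add_le_of_energyOn_le (hi' := hi') hΩb hp0 hlo hhi hE₀ hq0
      hlo' hE₀' C₀
    refine ⟨C, fun A σ f u Du hA hAδ _ hσ _ _ hσA _ hf hu => ⟨?_, ?_, ?_⟩⟩
    · calc gradNorm (outerPhase Ω A) p Du = (gradNorm (outerPhase Ω A) p Du ^ p) ^ (1 / p) :=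
            (gradNorm_rpow_rpow hp0 Du).symm
        _ ≤ _ := by gcongr; exact le_self_add
    · calc gradNorm A q Du ^ (q / p) = (gradNorm A q Du ^ q) ^ (1 / p) := by
            rw [← ENNReal.rpow_mul, mul_one_div]
        _ ≤ _ := by gcongr; exact le_add_self
    · obtain ⟨F, DF, hF, hDF, hzero⟩ := hC₀ f hf
      -- The extension competes through the `W^{1,p}` alternative and has no energy in `A`, so `q`
      -- does not affect the upper bound.
      have hle := hu.2 F DF (Or.inl hF)
      rw [energyOn_eq_zero hA.lipschitz.isOpen.measurableSet
        (hzero A hA.lipschitz.isOpen hAδ), add_zero] at hle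
      exact hC _ A σ Du DF _ (hB A) hσ hσA hDF hle
  -- The behaviour of the extension inside `A` is irrelevant here, so `C` involves no distance from
  -- `A` to `∂Ω`.
  · obtain ⟨C₀, hC₀⟩ := exists_extension hn hΩ hp one_pos
    obtain ⟨C, hC⟩ := exists_gradNorm_le_of_energyOn_le hΩb hp0 hlo hhi hE₀ C₀
    refine ⟨C, fun A σ f u Du _ _ hσ _ _ hf hu => ?_⟩
    obtain ⟨F, DF, hF, hDF, -⟩ := hC₀ f hf
    exact hC _ σ Du DF _ (hB A) hσ hDF (hu.2 F DF (hF.mono (hB A)))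
  · intro δ hδ
    obtain ⟨C₀, hC₀⟩ := exists_extension hn hΩ hp hδ
    obtain ⟨C, hC⟩ := exists_gradNorm_le_of_energyOn_le hΩb hp0 hlo hhi hE₀ C₀
    refine ⟨C, fun A σ f u Du hA hAδ _ hσ _ _ hf hu => ?_⟩
    obtain ⟨F, DF, hF, hDF, hzero⟩ := hC₀ f hf
    -- The cutoff makes the gradient vanish in `A`, which is the constraint on competitors for a
    -- perfect conductor.
    exact hC _ σ Du DF _ (hB A) hσ hDF (hu.2 F DF ⟨hF,
      ae_restrict_of_forall_mem hA.lipschitz.isOpen.measurableSet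
        (hzero A hA.lipschitz.isOpen hAδ)⟩)
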